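/- For a prime $p$, a subgroup $G$ of $\mathbb{F}_p^*$ and a function $\varphi:G\to\mathbb{F}_p$, put $\mu(\varphi)=\max_{t\in\mathbb{F}_p}|\{x\in G:\varphi(x)=t\}|$. For every real $\alpha$ with $1/2<\alpha<1$ there is $\Delta=\Delta(\alpha)>0$ such that the following holds. For all real numbers $c_1,c_2>0$ and all natural numbers $m,M$ there is a constant $c>0$, depending only on $\alpha,c_1,c_2,m,M$, such that for every prime $p$, every subgroup $G$ of $\mathbb{F}_p^*$, all functions $g,h:G\to\mathbb{F}_p^*$ with $\mu(g)\le m$, every function $w:G\to\mathbb{F}_p$ with $\mu(w)\le M$, and every $A\subset G$ with $c_1p^\alpha\le|A|\le c_2p^\alpha$, writing $f(x,y)=g(x)(h(x)+y)$, one has $$\max\bigl(|\{f(x,y):x,y\in A\}|,\ |\{w(x)+f(x,y):x,y\in A\}|\bigr)\ \ge\ c\,|A|^{1+\Delta}.$$ -/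

import Mathlib

/-- `maxFiber φ` is `max_t |{x ∈ G : φ(x) = t}|`, for a function `φ` from a subgroup `G` of the
multiplicative group of the field with `p` elements to that field. -/
noncomputable def maxFiber {p : ℕ} [Fact p.Prime] {G : Subgroup (ZMod p)ˣ} (φ : G → ZMod p) : ℕ :=
  Finset.univ.sup fun t : ZMod p => {x : G | φ x = t}.ncard

/-- The function `f(x, y) = g(x) (h(x) + y)` on `G × G`, with values in the prime field. -/
def twoVar {p : ℕ} {G : Subgroup (ZMod p)ˣ} (g h : G → (ZMod p)ˣ) (x y : G) : ZMod p :=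
  (g x : ZMod p) * ((h x : ZMod p) + ((y : (ZMod p)ˣ) : ZMod p))

/-- The additive `w`-shift `S_w(f)(x, y) = w(x) + f(x, y)`. -/
def addShift {p : ℕ} {G : Subgroup (ZMod p)ˣ} (w : G → ZMod p) (f : G → G → ZMod p)
    (x y : G) : ZMod p :=
  w x + f x y

/-! Each `x` in `A` gives an affine map `y ↦ g x * y + b x` with `b = g h`; adding `w` gives a
second family with the same slopes. Suppose both families send `A` into sets of size at most `K|A|`,
where `K` is a small power of `p`.

The core is `exists_line`: a single such family must have many points `(g x, b x)` on one line, i.e.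
many of its maps take a common value at a common point. To see this, run the random walk on the
affine group whose step applies one random map and then the inverse of another. By Cauchy–Schwarz
and pruning, some `A' ⊆ A` has the property that from each of its points a proportion at least
`1/(4K)` of the steps lands in `A'`. A second moment argument, resting on a point-line incidence
bound for `|A|` well below `p` and `|A|` well above `√p`, shows that mass carrying points of `A'`
into `A'` sits mostly on popular maps, of which there are few per slope (`unpopular_mass_le`). Along
surviving steps the law of the slope either flattens by a factor `r` or is stuck; it cannot flatten
for long in a field of size `p` (`exists_stuckMass_gt`). A stuck step yields many algebraic
relations between short lists of intercepts (`exists_slope_many_links`), and eliminating an unknown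
between two of them puts many `(g x, b x)` on a line (`exists_line_of_links`).

Applying this to the first family, and then to the second on the surviving indices, makes `b` and `b
+ w` both affine functions of `g` there, so `w = c' g + d'`. Small fibres of `w` force `c' ≠ 0`: the
two families have different centres. The incidence bound then rules out two small images
(`card_mul_card_le_of_two_centres`). -/

namespace AffineWalk

open Finset
open scoped Classical

/-! ### Point-line incidences over a finite field, by second moments. -/

section Incidence

variable {F : Type*} [Field F] [Fintype F]

/-- Second moment of the deviation of the number of lines through a point. -/
theorem sum_sq_lineCount_sub_le {κ : Type*} [Fintype κ] (L : κ → F × F) (m : ℝ)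
    (hL : ∀ v, ((univ.filter fun k => L k = v).card : ℝ) ≤ m) :
    ∑ v : F × F, (∑ k, ((if v.2 = (L k).1 * v.1 + (L k).2 then (1 : ℝ) else 0)
      - 1 / (Fintype.card F : ℝ))) ^ 2 ≤ Fintype.card F * m * Fintype.card κ := by
  set q : ℝ := (Fintype.card F : ℝ) with hq
  have hq0 : 0 < q := by rw [hq]; exact_mod_cast Fintype.card_pos
  have hone : ∀ k : κ, ∑ v : F × F, (if v.2 = (L k).1 * v.1 + (L k).2 then (1 : ℝ) else 0) = q := by
    intro k
    rw [Fintype.sum_prod_type]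
    simp [hq]
  -- Each line has `q` points, so the covariance sum is the number of common points minus `1`:
  -- nonpositive for distinct non-vertical lines, less than `q` for equal ones.
  have hpair : ∀ k k' : κ, ∑ v : F × F,
      ((if v.2 = (L k).1 * v.1 + (L k).2 then (1 : ℝ) else 0) - 1 / q) *
      ((if v.2 = (L k').1 * v.1 + (L k').2 then (1 : ℝ) else 0) - 1 / q)
      ≤ if L k' = L k then q else 0 := by
    intro k k'
    have e1 : ∀ v : F × F,
      ((if v.2 = (L k).1 * v.1 + (L k).2 then (1 : ℝ) else 0) - 1 / q) *
      ((if v.2 = (L k').1 * v.1 + (L k').2 then (1 : ℝ) else 0) - 1 / q)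
      = (if v.2 = (L k).1 * v.1 + (L k).2 then
          (if v.2 = (L k').1 * v.1 + (L k').2 then (1 : ℝ) else 0) else 0)
        - (1 / q) * (if v.2 = (L k).1 * v.1 + (L k).2 then (1 : ℝ) else 0)
        - (1 / q) * (if v.2 = (L k').1 * v.1 + (L k').2 then (1 : ℝ) else 0)
        + 1 / q * (1 / q) := by
      intro v
      split_ifs <;> ring
    simp_rw [e1]
    rw [sum_add_distrib, sum_sub_distrib, sum_sub_distrib, ← mul_sum, ← mul_sum, hone, hone]
    have e2 : ∑ _v : F × F, 1 / q * (1 / q) = 1 := by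
      simp only [sum_const, card_univ, Fintype.card_prod, nsmul_eq_mul, Nat.cast_mul, ← hq]
      field_simp
    rw [e2]
    have e3 : 1 / q * q = 1 := by field_simp
    rw [e3]
    have e4 : ∑ v : F × F, (if v.2 = (L k).1 * v.1 + (L k).2 then
          (if v.2 = (L k').1 * v.1 + (L k').2 then (1 : ℝ) else 0) else 0)
        = ((univ.filter fun t : F => (L k).1 * t + (L k).2 = (L k').1 * t + (L k').2).card : ℝ) := by
      rw [Fintype.sum_prod_type, card_filter]
      push_cast
      refine sum_congr rfl fun t _ => ?_
      simp
    rw [e4]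
    by_cases h : L k' = L k
    · have : ((univ.filter fun t : F =>
          (L k).1 * t + (L k).2 = (L k').1 * t + (L k').2).card : ℝ) ≤ q := by
        rw [hq]; exact_mod_cast card_le_univ _
      rw [if_pos h]; linarith
    · have : ((univ.filter fun t : F =>
          (L k).1 * t + (L k).2 = (L k').1 * t + (L k').2).card : ℝ) ≤ 1 := by
        norm_cast
        rw [card_le_one]
        intro a ha c hc
        simp only [mem_filter, mem_univ, true_and] at ha hc
        by_contra hac
        apply h
        have h1 : ((L k).1 - (L k').1) * (a - c) = 0 := by linear_combination ha - hc
        have h2 : (L k).1 = (L k').1 := by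
          rcases mul_eq_zero.1 h1 with h' | h'
          · exact sub_eq_zero.1 h'
          · exact absurd (sub_eq_zero.1 h') hac
        rw [h2] at ha
        exact Prod.ext h2.symm (add_left_cancel ha).symm
      rw [if_neg h]; linarith
  have hexp : ∑ v : F × F, (∑ k, ((if v.2 = (L k).1 * v.1 + (L k).2 then (1 : ℝ) else 0)
      - 1 / q)) ^ 2 = ∑ k, ∑ k', ∑ v : F × F,
      ((if v.2 = (L k).1 * v.1 + (L k).2 then (1 : ℝ) else 0) - 1 / q) *
      ((if v.2 = (L k').1 * v.1 + (L k').2 then (1 : ℝ) else 0) - 1 / q) := by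
    simp_rw [sq, sum_mul_sum]
    rw [sum_comm]
    refine sum_congr rfl fun k _ => ?_
    rw [sum_comm]
  rw [hexp]
  calc _ ≤ ∑ k, ∑ k', (if L k' = L k then q else 0) :=
        sum_le_sum fun k _ => sum_le_sum fun k' _ => hpair k k'
    _ = ∑ k, q * ((univ.filter fun k' => L k' = L k).card : ℝ) := by
        refine sum_congr rfl fun k _ => ?_
        rw [← sum_filter, sum_const, nsmul_eq_mul, mul_comm]
    _ ≤ ∑ _k : κ, q * m := sum_le_sum fun k _ => mul_le_mul_of_nonneg_left (hL _) hq0.le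
    _ = q * m * Fintype.card κ := by simp [mul_comm]

/-- A point-line incidence bound over a finite field, for families of points and of non-vertical
lines with multiplicities. -/
theorem incidence_le {I κ : Type*} [Fintype I] [Fintype κ] (P : I → F × F) (L : κ → F × F)
    (m₁ m₂ : ℝ) (hm₁ : 0 ≤ m₁)
    (hP : ∀ v, ((univ.filter fun i => P i = v).card : ℝ) ≤ m₁)
    (hL : ∀ v, ((univ.filter fun k => L k = v).card : ℝ) ≤ m₂) :
    ∑ i, ∑ k, (if (P i).2 = (L k).1 * (P i).1 + (L k).2 then (1 : ℝ) else 0) ≤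
      Fintype.card I * Fintype.card κ / Fintype.card F
      + √(Fintype.card F * m₁ * m₂ * Fintype.card I * Fintype.card κ) := by
  set q : ℝ := (Fintype.card F : ℝ) with hq
  set φ : F × F → ℝ := fun v => ∑ k, ((if v.2 = (L k).1 * v.1 + (L k).2 then (1 : ℝ) else 0)
      - 1 / q) with hφ
  have h1 : ∑ i, ∑ k, (if (P i).2 = (L k).1 * (P i).1 + (L k).2 then (1 : ℝ) else 0)
      = Fintype.card I * Fintype.card κ / q + ∑ i, φ (P i) := by
    simp only [hφ, sum_sub_distrib]
    simp
    ring
  rw [h1]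
  gcongr
  apply Real.le_sqrt_of_sq_le
  have h2 : ∑ i, φ (P i) ^ 2 ≤ m₁ * ∑ v, φ v ^ 2 := by
    have : ∑ i, φ (P i) ^ 2 = ∑ v, ((univ.filter fun i => P i = v).card : ℝ) * φ v ^ 2 := by
      rw [← sum_fiberwise univ P (fun i => φ (P i) ^ 2)]
      refine sum_congr rfl fun v _ => ?_
      rw [sum_congr rfl (g := fun _ => φ v ^ 2), sum_const, nsmul_eq_mul]
      intro i hi
      rw [(mem_filter.1 hi).2]
    rw [this, mul_sum]
    exact sum_le_sum fun v _ => mul_le_mul_of_nonneg_right (hP v) (sq_nonneg _)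
  have h3 := sum_sq_lineCount_sub_le L m₂ hL
  calc (∑ i, φ (P i)) ^ 2 ≤ Fintype.card I * ∑ i, φ (P i) ^ 2 := by
        simpa using sq_sum_le_card_mul_sum_sq (s := univ) (f := fun i => φ (P i))
    _ ≤ Fintype.card I * (m₁ * (q * m₂ * Fintype.card κ)) := by
        refine mul_le_mul_of_nonneg_left (h2.trans ?_) (Nat.cast_nonneg _)
        exact mul_le_mul_of_nonneg_left h3 hm₁
    _ = _ := by ring

end Incidence

/-! ### Pruning to large minimum degree. -/

/-- A dense symmetric weight has a subset of large minimum degree. -/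
theorem exists_subset_le_degree {V : Type*} (c : V → V → ℝ) (hsymm : ∀ a b, c a b = c b a)
    (hnn : ∀ a b, 0 ≤ c a b) (A : Finset V) (E : ℝ) (hE : 0 < E) (hA : A.Nonempty)
    (h : E * A.card ≤ ∑ a ∈ A, ∑ b ∈ A, c a b) :
    ∃ B ⊆ A, B.Nonempty ∧ ∀ a ∈ B, E / 4 ≤ ∑ b ∈ B, c a b := by
  -- At a maximiser of total weight minus `E / 2 * |B|`, deleting a vertex of degree below `E / 4`
  -- would increase the functional; its value at `A` is positive, so the maximiser is nonempty.
  obtain ⟨B, hB, hmax⟩ := exists_max_image A.powerset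
    (fun B => ∑ a ∈ B, ∑ b ∈ B, c a b - E / 2 * B.card) ⟨A, mem_powerset_self A⟩
  have hApos : (0 : ℝ) < A.card := by exact_mod_cast hA.card_pos
  have hBA := hmax A (mem_powerset_self A)
  refine ⟨B, mem_powerset.1 hB, ?_, ?_⟩
  · rw [nonempty_iff_ne_empty]
    rintro rfl
    simp only [sum_empty, card_empty, Nat.cast_zero, mul_zero, sub_zero] at hBA
    nlinarith [mul_pos hE hApos]
  · intro a ha
    have h1 := hmax (B.erase a) (mem_powerset.2 ((erase_subset a B).trans (mem_powerset.1 hB)))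
    have hcard : ((B.erase a).card : ℝ) = B.card - 1 := by
      rw [card_erase_of_mem ha, Nat.cast_sub (card_pos.2 ⟨a, ha⟩)]; simp
    have hsplit : ∑ x ∈ B, ∑ y ∈ B, c x y
        = ∑ x ∈ B.erase a, ∑ y ∈ B.erase a, c x y + 2 * ∑ y ∈ B, c a y - c a a := by
      have e1 : ∀ x, ∑ y ∈ B, c x y = ∑ y ∈ B.erase a, c x y + c x a := fun x =>
        (sum_erase_add B _ ha).symm
      rw [← sum_erase_add B _ ha]
      simp_rw [e1, sum_add_distrib]
      rw [sum_congr rfl (fun x _ => hsymm x a)]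
      ring
    have := hnn a a
    rw [hcard, hsplit] at h1
    linarith

/-! ### The random walk on the affine group, and popular maps. -/

section Walk

variable {F ι : Type*} [Field F] [Fintype ι] (g b : ι → F)

/-- The affine map `y ↦ v.1 * y + v.2` followed by `y ↦ g x * y + b x` and then by the inverse of
`y ↦ g z * y + b z`, again written as a pair (slope, intercept). -/
noncomputable def step (x z : ι) (v : F × F) : F × F :=
  (g x * v.1 / g z, (g x * v.2 + b x - b z) / g z)

/-- The average of `f` over one random step from `v`. -/
noncomputable def stepMean (f : F × F → ℝ) (v : F × F) : ℝ :=
  (∑ x, ∑ z, f (step g b x z v)) / (Fintype.card ι : ℝ) ^ 2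

theorem stepMean_nonneg {f : F × F → ℝ} (h : ∀ v, 0 ≤ f v) (v : F × F) :
    0 ≤ stepMean g b f v :=
  div_nonneg (sum_nonneg fun _ _ => sum_nonneg fun _ _ => h _) (sq_nonneg _)

theorem stepMean_const [Nonempty ι] (a : ℝ) (v : F × F) : stepMean g b (fun _ => a) v = a := by
  have : (Fintype.card ι : ℝ) ≠ 0 := by exact_mod_cast Fintype.card_ne_zero
  simp only [stepMean, sum_const, card_univ, nsmul_eq_mul]
  field_simp

variable [Fintype F]

/-- The law of the random affine map obtained from the identity by `n` independent steps. -/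
noncomputable def law : ℕ → F × F → ℝ
  | 0, v => if v = (1, 0) then 1 else 0
  | n + 1, v => ∑ u, law n u * stepMean g b (fun w => if w = v then 1 else 0) u

/-- The law of the slope of the random affine map after `n` steps. -/
noncomputable def slopeLaw (n : ℕ) (s : F) : ℝ := ∑ c, law g b n (s, c)

/-- `v` is popular if it carries a proportion at least `δ` of the mass of all maps of its slope. -/
def Popular (δ : ℝ) (n : ℕ) (v : F × F) : Prop :=
  0 < law g b n v ∧ δ * slopeLaw g b n v.1 ≤ law g b n v

theorem sum_stepMean_mul (f : F × F → ℝ) (u : F × F) :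
    ∑ v, stepMean g b (fun w => if w = v then 1 else 0) u * f v = stepMean g b f u := by
  unfold stepMean
  simp_rw [div_mul_eq_mul_div]
  rw [← sum_div]
  congr 1
  simp_rw [sum_mul]
  rw [sum_comm]
  refine sum_congr rfl fun x _ => ?_
  rw [sum_comm]
  refine sum_congr rfl fun z _ => ?_
  simp

/-- Duality between evolving the law and averaging the test function; it turns a bound on an event
at time `n + 1` into one on the chance of stepping into it from time `n`. -/
theorem sum_law_succ (n : ℕ) (f : F × F → ℝ) :
    ∑ v, law g b (n + 1) v * f v = ∑ u, law g b n u * stepMean g b f u := by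
  simp only [law, sum_mul]
  rw [sum_comm]
  refine sum_congr rfl fun u _ => ?_
  rw [← sum_stepMean_mul, mul_sum]
  exact sum_congr rfl fun v _ => by ring

theorem law_nonneg (n : ℕ) (v : F × F) : 0 ≤ law g b n v := by
  induction n generalizing v with
  | zero => simp only [law]; split_ifs <;> norm_num
  | succ n ih =>
    exact sum_nonneg fun u _ => mul_nonneg (ih u)
      (stepMean_nonneg g b (fun w => by split_ifs <;> norm_num) u)

theorem sum_law [Nonempty ι] (n : ℕ) : ∑ v, law g b n v = 1 := by
  induction n with
  | zero => simp [law]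
  | succ n ih =>
    have := sum_law_succ g b n (fun _ => 1)
    simp only [mul_one, stepMean_const, ih] at this
    exact this

theorem slopeLaw_nonneg (n : ℕ) (s : F) : 0 ≤ slopeLaw g b n s :=
  sum_nonneg fun _ _ => law_nonneg g b n _

theorem law_le_slopeLaw (n : ℕ) (s c : F) : law g b n (s, c) ≤ slopeLaw g b n s :=
  single_le_sum (f := fun c => law g b n (s, c)) (fun _ _ => law_nonneg g b n _) (mem_univ c)

theorem sum_slopeLaw [Nonempty ι] (n : ℕ) : ∑ s, slopeLaw g b n s = 1 := by
  rw [← sum_law g b n, Fintype.sum_prod_type]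
  rfl

/-- Slopes are products of nonzero quotients. Hence every map charged by the walk is injective,
which the second moment argument needs. -/
theorem law_zero_slope (hg : ∀ x, g x ≠ 0) (n : ℕ) (c : F) : law g b n (0, c) = 0 := by
  induction n generalizing c with
  | zero => simp [law]
  | succ n ih =>
    simp only [law]
    refine sum_eq_zero fun u _ => ?_
    by_cases hu : u.1 = 0
    · obtain ⟨u1, u2⟩ := u
      simp only at hu
      rw [hu, ih, zero_mul]
    · have : stepMean g b (fun w => if w = (0, c) then (1 : ℝ) else 0) u = 0 := by
        unfold stepMean
        rw [sum_eq_zero, zero_div]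
        intro x _
        refine sum_eq_zero fun z _ => ?_
        refine if_neg fun h => ?_
        have := congrArg Prod.fst h
        simp [step, hg, hu] at this
      rw [this, mul_zero]

/-- Each popular intercept takes a share at least `δ` of the mass of its slope. This is the length
of the lists that enter the links. -/
theorem card_popular_le {δ : ℝ} (hδ : 0 < δ) (n : ℕ) (s : F) :
    ((univ.filter fun c => Popular g b δ n (s, c)).card : ℝ) ≤ 1 / δ := by
  rcases (univ.filter fun c => Popular g b δ n (s, c)).eq_empty_or_nonempty with h | ⟨c₀, hc₀⟩
  · rw [h]; simp; exact hδ.le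
  · have hc₀' := (mem_filter.1 hc₀).2
    have hμ : 0 < slopeLaw g b n s := hc₀'.1.trans_le (law_le_slopeLaw g b n s c₀)
    have h1 : ((univ.filter fun c => Popular g b δ n (s, c)).card : ℝ) * (δ * slopeLaw g b n s)
        ≤ slopeLaw g b n s := by
      rw [← nsmul_eq_mul]
      refine (card_nsmul_le_sum _ (fun c => law g b n (s, c)) _ ?_).trans ?_
      · intro c hc
        exact (mem_filter.1 hc).2.2
      · exact sum_le_sum_of_subset_of_nonneg (subset_univ _) fun c _ _ => law_nonneg g b n _
    rw [le_div_iff₀ hδ]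
    by_contra! hcon
    nlinarith

/-- A second moment bound: if mass is distributed so that no atom has more than a proportion `δ` of
its fibre, and the tests of two distinct atoms of a fibre are almost never passed together, then
the tests are rarely passed. -/
theorem sq_sum_test_le {Ω S C : Type*} [Fintype S] [Fintype C] (O : Finset Ω)
    (w : S → C → ℝ) (μ : S → ℝ) (t : Ω → S → C → ℝ) (δ ε : ℝ)
    (hw : ∀ s c, 0 ≤ w s c) (hwμ : ∀ s, ∑ c, w s c ≤ μ s) (hμ : ∑ s, μ s ≤ 1)
    (hδ : 0 ≤ δ) (hε : 0 ≤ ε) (hwδ : ∀ s c, w s c ≤ δ * μ s)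
    (ht0 : ∀ o s c, 0 ≤ t o s c) (ht1 : ∀ o s c, t o s c ≤ 1)
    (ht : ∀ s, 0 < μ s → ∀ c c', c ≠ c' → ∑ o ∈ O, t o s c * t o s c' ≤ ε * O.card) :
    (∑ o ∈ O, ∑ s, ∑ c, w s c * t o s c) ^ 2 ≤ (δ + ε) * (O.card : ℝ) ^ 2 := by
  have hμ0 : ∀ s, 0 ≤ μ s := fun s => (sum_nonneg fun c _ => hw s c).trans (hwμ s)
  have hY0 : ∀ o s, 0 ≤ ∑ c, w s c * t o s c := fun o s =>
    sum_nonneg fun c _ => mul_nonneg (hw s c) (ht0 o s c)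
  have hYμ : ∀ o s, ∑ c, w s c * t o s c ≤ μ s := fun o s =>
    (sum_le_sum fun c _ => mul_le_of_le_one_right (hw s c) (ht1 o s c)).trans (hwμ s)
  -- Expanding the square, the diagonal contributes at most `δ * μ s ^ 2` because atoms are small,
  -- and distinct pairs at most `ε * μ s ^ 2`, both times `|O|`.
  have hfib : ∀ s, ∑ o ∈ O, (∑ c, w s c * t o s c) ^ 2 / μ s ≤ (δ + ε) * O.card * μ s := by
    intro s
    rcases (hμ0 s).eq_or_lt with h | h
    · simp [← h]
    rw [← sum_div, div_le_iff₀ h]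
    have e1 : ∑ o ∈ O, (∑ c, w s c * t o s c) ^ 2
        = ∑ c, ∑ c', w s c * w s c' * ∑ o ∈ O, t o s c * t o s c' := by
      simp_rw [sq, sum_mul_sum, mul_sum]
      rw [sum_comm]
      refine sum_congr rfl fun c _ => ?_
      rw [sum_comm]
      refine sum_congr rfl fun c' _ => sum_congr rfl fun o _ => by ring
    have e2 : ∀ c c', ∑ o ∈ O, t o s c * t o s c' ≤ (if c' = c then (1 : ℝ) else 0) * O.card
        + ε * O.card := by
      intro c c'
      split_ifs with hcc
      · have : ∑ o ∈ O, t o s c * t o s c' ≤ ∑ o ∈ O, (1 : ℝ) :=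
          sum_le_sum fun o _ => mul_le_one₀ (ht1 _ _ _) (ht0 _ _ _) (ht1 _ _ _)
        simp only [sum_const, nsmul_eq_mul, mul_one] at this
        have := mul_nonneg hε (Nat.cast_nonneg (α := ℝ) O.card)
        linarith
      · simpa using ht s h c c' (Ne.symm hcc)
    have hN : (0 : ℝ) ≤ O.card := Nat.cast_nonneg _
    calc ∑ o ∈ O, (∑ c, w s c * t o s c) ^ 2
        ≤ ∑ c, ∑ c', w s c * w s c' *
            ((if c' = c then (1 : ℝ) else 0) * O.card + ε * O.card) := by
          rw [e1]
          exact sum_le_sum fun c _ => sum_le_sum fun c' _ =>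
            mul_le_mul_of_nonneg_left (e2 c c') (mul_nonneg (hw _ _) (hw _ _))
      _ = (∑ c, w s c * w s c) * O.card + ε * O.card * ((∑ c, w s c) * ∑ c, w s c) := by
          simp_rw [mul_add, sum_add_distrib]
          congr 1
          · rw [sum_mul]
            refine sum_congr rfl fun c _ => ?_
            rw [sum_eq_single c]
            · simp
            · intro c' _ hc'; simp [hc']
            · simp
          · rw [sum_mul_sum, mul_sum]
            refine sum_congr rfl fun c _ => ?_
            rw [mul_sum]
            exact sum_congr rfl fun c' _ => by ring
      _ ≤ (δ * μ s * μ s) * O.card + ε * O.card * (μ s * μ s) := by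
          have h1 : ∑ c, w s c * w s c ≤ δ * μ s * μ s := by
            calc ∑ c, w s c * w s c ≤ ∑ c, δ * μ s * w s c :=
                  sum_le_sum fun c _ => mul_le_mul_of_nonneg_right (hwδ s c) (hw s c)
              _ = δ * μ s * ∑ c, w s c := by rw [mul_sum]
              _ ≤ _ := mul_le_mul_of_nonneg_left (hwμ s) (mul_nonneg hδ h.le)
          have h2 : (∑ c, w s c) * ∑ c, w s c ≤ μ s * μ s :=
            mul_le_mul (hwμ s) (hwμ s) (sum_nonneg fun c _ => hw s c) h.le
          gcongr
      _ = _ := by ring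
  -- Cauchy–Schwarz with weights `μ`. A fibre with `μ s = 0` carries no weight, so division by zero
  -- there is harmless.
  have hcs : (∑ o ∈ O, ∑ s, ∑ c, w s c * t o s c) ^ 2 ≤
      (∑ p ∈ O ×ˢ (univ : Finset S), μ p.2) *
      ∑ p ∈ O ×ˢ (univ : Finset S), (∑ c, w p.2 c * t p.1 p.2 c) ^ 2 / μ p.2 := by
    rw [← sum_product' O univ (fun o s => ∑ c, w s c * t o s c)]
    refine sum_sq_le_sum_mul_sum_of_sq_le_mul _ (fun p _ => hμ0 _)
      (fun p _ => div_nonneg (sq_nonneg _) (hμ0 _)) fun p _ => ?_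
    rcases (hμ0 p.2).eq_or_lt with h | h
    · have := le_antisymm ((hYμ p.1 p.2).trans_eq h.symm) (hY0 _ _)
      rw [this, ← h]; simp
    · rw [mul_div_cancel₀ _ h.ne']
  refine hcs.trans ?_
  rw [sum_product, sum_product_right]
  simp only [sum_const, nsmul_eq_mul]
  have h5 : ∑ s, ∑ o ∈ O, (∑ c, w s c * t o s c) ^ 2 / μ s ≤ (δ + ε) * O.card := by
    calc _ ≤ ∑ s, (δ + ε) * O.card * μ s := sum_le_sum fun s _ => hfib s
      _ = (δ + ε) * O.card * ∑ s, μ s := by rw [mul_sum]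
      _ ≤ _ := mul_le_of_le_one_right (by positivity) hμ
  have h6 : (O.card : ℝ) * ∑ s, μ s ≤ O.card := mul_le_of_le_one_right (Nat.cast_nonneg _) hμ
  calc _ ≤ (O.card : ℝ) * ((δ + ε) * O.card) := by
        refine mul_le_mul h6 h5 ?_ (Nat.cast_nonneg _)
        exact sum_nonneg fun s _ => sum_nonneg fun o _ => div_nonneg (sq_nonneg _) (hμ0 _)
    _ = _ := by ring

end Walk

/-! ### Unpopular mass is small; slopes seldom concentrate. -/

section Spread

theorem sum_eq_sum_mul_right {F : Type*} [Field F] [Fintype F] {c : F} (hc : c ≠ 0) (f : F → ℝ) :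
    ∑ s, f s = ∑ k, f (k * c) :=
  (Equiv.sum_comp (Equiv.mulRight₀ c hc) f).symm

variable {F ι : Type*} [Field F] (g b : ι → F)

theorem step_eval (hg : ∀ x, g x ≠ 0) (x z : ι) (v : F × F) (a : F) :
    (step g b x z v).1 * a + (step g b x z v).2 = (g x * (v.1 * a + v.2) + b x - b z) / g z := by
  have := hg z
  simp only [step]
  field_simp
  ring

variable [Fintype ι] [Fintype F]

/-- A set of size much less than the field has few pairs of points whose difference is a given
nonzero multiple of a random quotient `g x / g z`. -/
theorem sum_dilate_le [Nonempty ι] (hg : ∀ x, g x ≠ 0) (m : ℝ)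
    (hm : ∀ s, ((univ.filter fun x => g x = s).card : ℝ) ≤ m) (B : Finset F) (d : F) (hd : d ≠ 0) :
    ∑ x, ∑ z, ∑ c ∈ B, (if c + g x / g z * d ∈ B then (1 : ℝ) else 0) ≤
      (B.card / Fintype.card F + m * √(Fintype.card F) / Fintype.card ι) *
        (B.card * (Fintype.card ι : ℝ) ^ 2) := by
  have hm0 : 0 ≤ m := (Nat.cast_nonneg _).trans (hm 0)
  have hN : (Fintype.card ι : ℝ) ≠ 0 := by exact_mod_cast Fintype.card_ne_zero
  -- With target `k`, the condition `c + g x / g z * d = k` reads `g x * d = g z * (k - c)`: the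
  -- point `(c, g x * d)` lies on the line of slope `-g z` and intercept `g z * k`. Since `d` and
  -- `g` do not vanish, no point or line is repeated more than `m` times.
  have key := incidence_le (F := F) (I := B × ι) (κ := B × ι)
    (fun i => ((i.1 : F), g i.2 * d)) (fun k => (-g k.2, g k.2 * (k.1 : F))) m m hm0 ?_ ?_
  · have hlhs : ∑ i : B × ι, ∑ k : B × ι, (if g i.2 * d = -g k.2 * (i.1 : F) + g k.2 * (k.1 : F)
          then (1 : ℝ) else 0)
        = ∑ x, ∑ z, ∑ c ∈ B, (if c + g x / g z * d ∈ B then (1 : ℝ) else 0) := by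
      simp_rw [Fintype.sum_prod_type_right]
      refine sum_congr rfl fun x _ => ?_
      rw [sum_comm]
      refine sum_congr rfl fun z _ => ?_
      rw [← sum_coe_sort B (fun c => if c + g x / g z * d ∈ B then (1 : ℝ) else 0)]
      refine sum_congr rfl fun c _ => ?_
      rw [sum_coe_sort B (fun k => if g x * d = -g z * (c : F) + g z * k then (1 : ℝ) else 0)]
      have : ∀ k : F, (g x * d = -g z * (c : F) + g z * k) ↔ (k = c + g x / g z * d) := by
        intro k
        have hz := hg z
        field_simp
        constructor
        · intro h; linear_combination -h
        · intro h; linear_combination -h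
      simp_rw [this]
      rw [sum_ite_eq' B]
    simp only at key
    rw [hlhs] at key
    refine key.trans (le_of_eq ?_)
    simp only [Fintype.card_prod, Fintype.card_coe, Nat.cast_mul]
    have : √((Fintype.card F : ℝ) * m * m * (B.card * Fintype.card ι) * (B.card * Fintype.card ι))
        = √(Fintype.card F) * (m * (B.card * Fintype.card ι)) := by
      rw [show (Fintype.card F : ℝ) * m * m * (B.card * Fintype.card ι) *
        (B.card * Fintype.card ι) = Fintype.card F * (m * (B.card * Fintype.card ι)) ^ 2 by ring,
        Real.sqrt_mul (Nat.cast_nonneg _), Real.sqrt_sq (by positivity)]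
    rw [this]
    field_simp
  · intro v
    refine le_trans ?_ (hm (v.2 / d))
    norm_cast
    refine card_le_card_of_injOn (fun i => i.2) ?_ ?_
    · intro i hi
      simp only [coe_filter, mem_univ, true_and, Set.mem_ofPred_eq] at hi ⊢
      rw [← hi]; field_simp
    · intro i hi j hj hij
      simp only [coe_filter, mem_univ, true_and, Set.mem_ofPred_eq] at hi hj
      have := congrArg Prod.fst (hi.trans hj.symm)
      exact Prod.ext (Subtype.ext this) hij
  · intro v
    refine le_trans ?_ (hm (-v.1))
    norm_cast
    refine card_le_card_of_injOn (fun i => i.2) ?_ ?_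
    · intro i hi
      simp only [coe_filter, mem_univ, true_and, Set.mem_ofPred_eq] at hi ⊢
      rw [← hi]; simp
    · intro i hi j hj hij
      simp only [coe_filter, mem_univ, true_and, Set.mem_ofPred_eq] at hi hj
      have h2 := congrArg Prod.snd (hi.trans hj.symm)
      simp only at h2 hij
      rw [hij] at h2
      exact Prod.ext (Subtype.ext (mul_left_cancel₀ (hg _) h2)) hij

/-- If `B` has large minimum degree for the steps, the walk is rarely at an unpopular map that
sends a random point of `B` into `B`. -/
theorem unpopular_mass_le [Nonempty ι] (hg : ∀ x, g x ≠ 0) (m : ℝ)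
    (hm : ∀ s, ((univ.filter fun x => g x = s).card : ℝ) ≤ m) (B : Finset F)
    (ρ η δ : ℝ) (hρ : 0 < ρ) (hη : 0 ≤ η) (hδ : 0 < δ)
    (hdeg : ∀ a ∈ B, ρ * (Fintype.card ι : ℝ) ^ 2 ≤
      ∑ x, ∑ z, if (g x * a + b x - b z) / g z ∈ B then (1 : ℝ) else 0)
    (hsmall : δ + (B.card / Fintype.card F + m * √(Fintype.card F) / Fintype.card ι)
      ≤ (ρ * η) ^ 2) (n : ℕ) :
    ∑ a ∈ B, ∑ v, law g b n v * (if v.1 * a + v.2 ∈ B ∧ ¬ Popular g b δ n v then (1 : ℝ) else 0)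
      ≤ B.card * η := by
  have hm0 : 0 ≤ m := (Nat.cast_nonneg _).trans (hm 0)
  have hN : (0 : ℝ) < Fintype.card ι := by exact_mod_cast Fintype.card_pos
  set ε : ℝ := B.card / Fintype.card F + m * √(Fintype.card F) / Fintype.card ι with hε
  have hε0 : 0 ≤ ε := by positivity
  -- The law restricted to unpopular maps. The test `t` below asks whether the map, followed by one
  -- more random step, sends a random point of `B` into `B`.
  set w : F → F → ℝ := fun s c => if Popular g b δ n (s, c) then 0 else law g b n (s, c) with hw
  have hw0 : ∀ s c, 0 ≤ w s c := by
    intro s c; simp only [hw]; split_ifs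
    · exact le_rfl
    · exact law_nonneg g b n _
  have hwl : ∀ s c, w s c ≤ law g b n (s, c) := by
    intro s c; simp only [hw]; split_ifs
    · exact law_nonneg g b n _
    · exact le_rfl
  set O : Finset (F × ι × ι) := B ×ˢ (univ ×ˢ univ) with hO
  have hOcard : (O.card : ℝ) = B.card * (Fintype.card ι : ℝ) ^ 2 := by
    simp [hO, sq]
  set t : F × ι × ι → F → F → ℝ := fun o s c =>
    if (g o.2.1 * (s * o.1 + c) + b o.2.1 - b o.2.2) / g o.2.2 ∈ B then 1 else 0 with ht
  have hmain := sq_sum_test_le O w (slopeLaw g b n) t δ ε hw0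
    (fun s => sum_le_sum fun c _ => hwl s c) (sum_slopeLaw g b n).le hδ.le hε0 ?_ ?_ ?_ ?_
  -- By the degree hypothesis, once a map sends `a` into `B` a proportion at least `ρ` of the next
  -- steps passes the test.
  · have hlow : ρ * (Fintype.card ι : ℝ) ^ 2 * ∑ a ∈ B, ∑ v, law g b n v *
        (if v.1 * a + v.2 ∈ B ∧ ¬ Popular g b δ n v then (1 : ℝ) else 0)
        ≤ ∑ o ∈ O, ∑ s, ∑ c, w s c * t o s c := by
      rw [hO, sum_product, mul_sum]
      refine sum_le_sum fun a _ => ?_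
      rw [sum_comm, mul_sum, Fintype.sum_prod_type]
      refine sum_le_sum fun s _ => ?_
      rw [sum_comm]
      refine sum_le_sum fun c _ => ?_
      rw [← mul_sum]
      by_cases h : s * a + c ∈ B ∧ ¬ Popular g b δ n (s, c)
      · rw [if_pos h]
        have h1 := hdeg _ h.1
        have h2 : w s c = law g b n (s, c) := by simp only [hw]; rw [if_neg h.2]
        rw [h2, sum_product, mul_one, mul_comm]
        exact mul_le_mul_of_nonneg_left h1 (law_nonneg g b n _)
      · rw [if_neg h, mul_zero, mul_zero]
        exact mul_nonneg (hw0 _ _) (sum_nonneg fun o _ => by simp only [ht]; split_ifs <;> norm_num)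
    have h1 : (∑ o ∈ O, ∑ s, ∑ c, w s c * t o s c) ^ 2 ≤ (ρ * η * O.card) ^ 2 := by
      refine hmain.trans ?_
      rw [mul_pow (ρ * η)]
      exact mul_le_mul_of_nonneg_right hsmall (sq_nonneg _)
    have h2 := abs_le_of_sq_le_sq' h1 (by positivity)
    have h3 := hlow.trans h2.2
    rw [hOcard] at h3
    have h4 : 0 < ρ * (Fintype.card ι : ℝ) ^ 2 := by positivity
    refine le_of_mul_le_mul_left ?_ h4
    linarith
  · intro s c
    simp only [hw]
    split_ifs with h
    · exact mul_nonneg hδ.le (slopeLaw_nonneg g b n s)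
    · rcases (law_nonneg g b n (s, c)).eq_or_lt with h0 | h0
      · rw [← h0]; exact mul_nonneg hδ.le (slopeLaw_nonneg g b n s)
      · by_contra! hcon
        exact h ⟨h0, hcon.le⟩
  · intro o s c; simp only [ht]; split_ifs <;> norm_num
  · intro o s c; simp only [ht]; split_ifs <;> norm_num
  · intro s hs c c' hcc
    -- Two maps of the same slope `s ≠ 0` and intercepts `c`, `c'` have, after a step, images
    -- differing by `g x / g z * (c' - c)`, and the image is injective in `a`; so joint passes are
    -- counted by `sum_dilate_le`.
    have hs0 : s ≠ 0 := by
      rintro rfl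
      simp [slopeLaw, law_zero_slope g b hg] at hs
    have hd := sum_dilate_le g hg m hm B (c' - c) (sub_ne_zero.2 hcc.symm)
    rw [hOcard]
    refine le_trans ?_ hd
    rw [hO, sum_product, sum_comm, sum_product]
    refine sum_le_sum fun x _ => sum_le_sum fun z _ => ?_
    simp only [ht]
    set y : F → F := fun a => (g x * (s * a + c) + b x - b z) / g z with hy
    have hyinj : Function.Injective y := by
      intro a a' haa
      simp only [hy] at haa
      have hz := hg z
      have hx := hg x
      field_simp at haa
      have h1 : g x * s * (a - a') = 0 := by linear_combination haa
      rcases mul_eq_zero.1 h1 with h | h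
      · exact absurd h (mul_ne_zero hx hs0)
      · exact sub_eq_zero.1 h
    have hshift : ∀ a, (g x * (s * a + c') + b x - b z) / g z = y a + g x / g z * (c' - c) := by
      intro a
      have hz := hg z
      simp only [hy]
      field_simp
      ring
    simp_rw [hshift]
    change ∑ a ∈ B, (if y a ∈ B then (1 : ℝ) else 0) *
      (if y a + g x / g z * (c' - c) ∈ B then (1 : ℝ) else 0) ≤ _
    rw [← sum_filter_add_sum_filter_not B (fun a => y a ∈ B)]
    rw [sum_eq_zero (s := B.filter fun a => ¬ y a ∈ B) (fun a ha => by
      rw [if_neg (mem_filter.1 ha).2, zero_mul]), add_zero]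
    rw [← sum_image (s := B.filter fun a => y a ∈ B) (g := y)
      (f := fun e => (if e ∈ B then (1 : ℝ) else 0) *
      (if e + g x / g z * (c' - c) ∈ B then (1 : ℝ) else 0)) (fun a _ a' _ h => hyinj h)]
    have hsub : image y (B.filter fun a => y a ∈ B) ⊆ B := by
      intro e he
      obtain ⟨a, ha, rfl⟩ := mem_image.1 he
      exact (mem_filter.1 ha).2
    refine (sum_le_sum_of_subset_of_nonneg hsub fun e _ _ => ?_).trans ?_
    · split_ifs <;> norm_num
    · refine sum_le_sum fun e _ => ?_
      split_ifs <;> norm_num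

/-- The law of the slope after `n` steps divided by the slope of one further random map. -/
noncomputable def quotLaw (n : ℕ) (k : F) : ℝ :=
  (∑ z, slopeLaw g b n (k * g z)) / Fintype.card ι

theorem quotLaw_nonneg (n : ℕ) (k : F) : 0 ≤ quotLaw g b n k :=
  div_nonneg (sum_nonneg fun _ _ => slopeLaw_nonneg g b n _) (Nat.cast_nonneg _)

theorem sum_quotLaw [Nonempty ι] (hg : ∀ x, g x ≠ 0) (n : ℕ) : ∑ k, quotLaw g b n k = 1 := by
  unfold quotLaw
  rw [← sum_div, sum_comm]
  simp_rw [← sum_eq_sum_mul_right (hg _) (slopeLaw g b n), sum_slopeLaw]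
  have : (Fintype.card ι : ℝ) ≠ 0 := by exact_mod_cast Fintype.card_ne_zero
  simp [this]

theorem sum_law_mul_slope (n : ℕ) (f : F → ℝ) :
    ∑ v : F × F, law g b n v * f v.1 = ∑ s, slopeLaw g b n s * f s := by
  rw [Fintype.sum_prod_type]
  simp only [slopeLaw, sum_mul]

/-- Markov's inequality: multiplying by one more random slope rarely makes the law of the slope
much larger. -/
theorem markov_slope [Nonempty ι] (hg : ∀ x, g x ≠ 0) (n : ℕ) (r : ℝ) (hr : 0 < r) :
    ∑ v : F × F, law g b n v * ((∑ x, ∑ z, if r * quotLaw g b n (v.1 / g z) <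
      slopeLaw g b (n + 1) (g x * v.1 / g z) then (1 : ℝ) else 0) / (Fintype.card ι : ℝ) ^ 2)
      ≤ 1 / r := by
  have hN : (0 : ℝ) < Fintype.card ι := by exact_mod_cast Fintype.card_pos
  rw [sum_law_mul_slope g b n (fun s => (∑ x, ∑ z, if r * quotLaw g b n (s / g z) <
      slopeLaw g b (n + 1) (g x * s / g z) then (1 : ℝ) else 0) / (Fintype.card ι : ℝ) ^ 2)]
  simp_rw [← mul_div_assoc]
  rw [← sum_div, div_le_div_iff₀ (by positivity) hr, one_mul]
  simp_rw [mul_sum]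
  rw [sum_comm]
  -- Substituting `s = k * g z` gathers the sum over `z` into `quotLaw k`; on the event this is
  -- below `slopeLaw (k * g x) / r`, and the slope law has total mass `1`.
  have hx : ∀ x, ∑ s, ∑ z, slopeLaw g b n s * (if r * quotLaw g b n (s / g z) <
      slopeLaw g b (n + 1) (g x * s / g z) then (1 : ℝ) else 0) ≤ Fintype.card ι / r := by
    intro x
    rw [sum_comm]
    calc _ = ∑ z, ∑ k, slopeLaw g b n (k * g z) * (if r * quotLaw g b n k <
              slopeLaw g b (n + 1) (k * g x) then (1 : ℝ) else 0) := by
          refine sum_congr rfl fun z _ => ?_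
          rw [sum_eq_sum_mul_right (hg z)]
          refine sum_congr rfl fun k _ => ?_
          have hz := hg z
          rw [mul_div_cancel_right₀ _ hz, show g x * (k * g z) / g z = k * g x by field_simp]
      _ = ∑ k, Fintype.card ι * (quotLaw g b n k * (if r * quotLaw g b n k <
              slopeLaw g b (n + 1) (k * g x) then (1 : ℝ) else 0)) := by
          rw [sum_comm]
          refine sum_congr rfl fun k _ => ?_
          rw [← sum_mul, quotLaw]
          field_simp
      _ ≤ ∑ k, Fintype.card ι * (slopeLaw g b (n + 1) (k * g x) / r) := by
          refine sum_le_sum fun k _ => mul_le_mul_of_nonneg_left ?_ hN.le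
          split_ifs with h
          · rw [mul_one, le_div_iff₀ hr]; linarith
          · rw [mul_zero]; exact div_nonneg (slopeLaw_nonneg g b _ _) hr.le
      _ = Fintype.card ι / r := by
          rw [← mul_sum, ← sum_div, ← sum_eq_sum_mul_right (hg x), sum_slopeLaw]
          ring
  calc _ ≤ (∑ _x : ι, (Fintype.card ι : ℝ) / r) * r :=
        mul_le_mul_of_nonneg_right (sum_le_sum fun x _ => hx x) hr.le
    _ = _ := by
        simp only [sum_const, card_univ, nsmul_eq_mul]
        field_simp

end Spread

/-! ### Flattening of the slope law, until the walk gets stuck. -/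

section Growth

variable {F ι : Type*} [Field F] [Fintype F] [Fintype ι] (g b : ι → F)

/-- The probability that the walk takes, from popular to popular, a step along which the law of the
slope does not spread. -/
noncomputable def stuckMass (δ r : ℝ) (n : ℕ) : ℝ :=
  ∑ v, law g b n v * ((∑ x, ∑ z, if Popular g b δ n v ∧ Popular g b δ (n + 1) (step g b x z v) ∧
    slopeLaw g b n v.1 ≤ r ^ 2 * quotLaw g b n (v.1 / g z) then (1 : ℝ) else 0)
      / (Fintype.card ι : ℝ) ^ 2)

/-- As long as the walk does not get stuck, much of its mass stays in `B`, at popular maps whose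
slopes are more and more spread. -/
theorem exists_alive_mass [Nonempty ι] (hg : ∀ x, g x ≠ 0) (B : Finset F)
    (ρ η δ δ' r : ℝ) (hρ : 0 < ρ) (hρ1 : ρ ≤ 1) (hδ1 : δ ≤ 1) (hr : 1 ≤ r) (hδ' : 0 ≤ δ')
    (hη : 0 ≤ η)
    (hdeg : ∀ a ∈ B, ρ * (Fintype.card ι : ℝ) ^ 2 ≤
      ∑ x, ∑ z, if (g x * a + b x - b z) / g z ∈ B then (1 : ℝ) else 0)
    (hunpop : ∀ n, ∑ a ∈ B, ∑ v, law g b n v *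
      (if v.1 * a + v.2 ∈ B ∧ ¬ Popular g b δ n v then (1 : ℝ) else 0) ≤ B.card * η)
    (J : ℕ) (hstuck : ∀ n < J, stuckMass g b δ r n ≤ δ') (n : ℕ) (hn : n ≤ J) :
    ∃ α : F → F × F → ℝ, (∀ a v, 0 ≤ α a v) ∧ (∀ a v, α a v ≤ law g b n v) ∧
      (∀ a ∈ B, ∀ v, α a v ≠ 0 → v.1 * a + v.2 ∈ B ∧ Popular g b δ n v ∧
        slopeLaw g b n v.1 ≤ (1 / r) ^ n) ∧
      B.card * (ρ ^ n - n * (η + δ' + 1 / r)) ≤ ∑ a ∈ B, ∑ v, α a v := by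
  have hr0 : 0 < r := by linarith
  have hN : (0 : ℝ) < Fintype.card ι := by exact_mod_cast Fintype.card_pos
  induction n with
  | zero =>
    refine ⟨fun _ => law g b 0, fun _ v => law_nonneg g b 0 v, fun _ v => le_rfl, ?_, ?_⟩
    · intro a ha v hv
      have hle : slopeLaw g b 0 v.1 ≤ 1 := by
        rw [← sum_slopeLaw g b 0]
        exact single_le_sum (f := slopeLaw g b 0) (fun s _ => slopeLaw_nonneg g b 0 s)
          (mem_univ _)
      have hv1 : v = (1, 0) := by
        by_contra h
        exact hv (by simp [law, h])
      have hl : law g b 0 v = 1 := by simp [law, hv1]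
      refine ⟨by simpa [hv1] using ha, ⟨by rw [hl]; exact one_pos, ?_⟩, by simpa using hle⟩
      rw [hl]
      nlinarith [slopeLaw_nonneg g b 0 v.1]
    · simp [sum_law]
  | succ n ih =>
    obtain ⟨α, hα0, hαl, hαs, hαm⟩ := ih (by omega)
    set D : F → F × F → Prop := fun a v => v.1 * a + v.2 ∈ B ∧ Popular g b δ (n + 1) v ∧
        slopeLaw g b (n + 1) v.1 ≤ (1 / r) ^ (n + 1) with hD
    set I : (F × F → Prop) → F × F → ℝ := fun p v => if p v then 1 else 0 with hI
    have hI0 : ∀ p v, 0 ≤ I p v := by intro p v; simp only [hI]; split_ifs <;> norm_num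
    -- Push the surviving mass one step forward and keep only what satisfies all three conditions at
    -- time `n + 1`.
    refine ⟨fun a v => if D a v then ∑ u, α a u * stepMean g b (I (· = v)) u else 0, ?_, ?_, ?_, ?_⟩
    · intro a v
      dsimp only
      split_ifs
      · exact sum_nonneg fun u _ => mul_nonneg (hα0 a u) (stepMean_nonneg g b (hI0 _) u)
      · exact le_rfl
    · intro a v
      dsimp only
      split_ifs
      · simp only [law]
        refine (sum_le_sum fun u _ => mul_le_mul_of_nonneg_right (hαl a u)
          (stepMean_nonneg g b (hI0 _) u)).trans_eq ?_
        simp only [hI]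
        congr!
      · exact law_nonneg g b _ _
    · intro a _ v hv
      dsimp only at hv
      by_contra h
      exact hv (if_neg h)
    · set S : F × F → ℝ := fun u => (∑ x, ∑ z, if Popular g b δ n u ∧
        Popular g b δ (n + 1) (step g b x z u) ∧
        slopeLaw g b n u.1 ≤ r ^ 2 * quotLaw g b n (u.1 / g z) then (1 : ℝ) else 0)
        / (Fintype.card ι : ℝ) ^ 2 with hS
      set T : F × F → ℝ := fun u => (∑ x, ∑ z, if r * quotLaw g b n (u.1 / g z) <
        slopeLaw g b (n + 1) (g x * u.1 / g z) then (1 : ℝ) else 0)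
        / (Fintype.card ι : ℝ) ^ 2 with hT
      set U : F → F × F → ℝ := fun a v =>
        if v.1 * a + v.2 ∈ B ∧ ¬ Popular g b δ (n + 1) v then (1 : ℝ) else 0 with hU
      have hS0 : ∀ u, 0 ≤ S u := fun u => div_nonneg
        (sum_nonneg fun _ _ => sum_nonneg fun _ _ => by split_ifs <;> norm_num) (sq_nonneg _)
      have hT0 : ∀ u, 0 ≤ T u := fun u => div_nonneg
        (sum_nonneg fun _ _ => sum_nonneg fun _ _ => by split_ifs <;> norm_num) (sq_nonneg _)
      have hU0 : ∀ a u, 0 ≤ U a u := fun a u => by simp only [hU]; split_ifs <;> norm_num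
      have hsum : ∀ a, ∑ v, (if D a v then ∑ u, α a u * stepMean g b (I (· = v)) u else 0)
          = ∑ u, α a u * stepMean g b (I (D a)) u := by
        intro a
        have : ∀ v, (if D a v then ∑ u, α a u * stepMean g b (I (· = v)) u else 0)
            = ∑ u, α a u * (stepMean g b (I (· = v)) u * I (D a) v) := by
          intro v
          simp only [hI]
          split_ifs <;> simp
        simp_rw [this]
        rw [sum_comm]
        refine sum_congr rfl fun u _ => ?_
        rw [← mul_sum]
        congr 1
        refine Eq.trans ?_ (sum_stepMean_mul g b (I (D a)) u)
        simp only [hI]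
        congr!
      have hpt : ∀ a ∈ B, ∀ u, α a u * ρ - law g b n u * stepMean g b (U a) u - law g b n u * S u
          - law g b n u * T u ≤ α a u * stepMean g b (I (D a)) u := by
        intro a ha u
        have hl := law_nonneg g b n u
        have hU' := stepMean_nonneg g b (hU0 a) u
        by_cases h0 : α a u = 0
        · rw [h0]
          have h1 := mul_nonneg hl hU'
          have h2 := mul_nonneg hl (hS0 u)
          have h3 := mul_nonneg hl (hT0 u)
          linarith
        · obtain ⟨hin, hpop, hslope⟩ := hαs a ha u h0
          -- A step landing in `B` reaches an unpopular map (`U`), is stuck (`S`), is exceptional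
          -- for Markov's inequality (`T`), or survives (`D`).
          have hmean : ρ ≤ stepMean g b (U a) u + S u + T u + stepMean g b (I (D a)) u := by
            simp only [hS, hT, stepMean]
            rw [← add_div, ← add_div, ← add_div, le_div_iff₀ (by positivity)]
            refine (hdeg _ hin).trans ?_
            simp only [← sum_add_distrib]
            refine sum_le_sum fun x _ => sum_le_sum fun z _ => ?_
            have hev := step_eval g b hg x z u a
            rw [← hev]
            by_cases hB : (step g b x z u).1 * a + (step g b x z u).2 ∈ B
            swap
            · rw [if_neg hB]
              refine add_nonneg (add_nonneg (add_nonneg (hU0 _ _) ?_) ?_) (hI0 _ _)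
              · split_ifs <;> norm_num
              · split_ifs <;> norm_num
            rw [if_pos hB]
            by_cases hP : Popular g b δ (n + 1) (step g b x z u)
            swap
            · have : U a (step g b x z u) = 1 := by simp only [hU]; exact if_pos ⟨hB, hP⟩
              rw [this, add_assoc, add_assoc]
              refine le_add_of_nonneg_right (add_nonneg ?_ (add_nonneg ?_ (hI0 _ _)))
              · split_ifs <;> norm_num
              · split_ifs <;> norm_num
            by_cases h2 : slopeLaw g b n u.1 ≤ r ^ 2 * quotLaw g b n (u.1 / g z)
            · rw [if_pos ⟨hpop, hP, h2⟩]
              have h3 := hU0 a (step g b x z u)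
              have h4 := hI0 (D a) (step g b x z u)
              split_ifs <;> linarith
            by_cases h3 : slopeLaw g b (n + 1) (step g b x z u).1 ≤ (1 / r) ^ (n + 1)
            · have : I (D a) (step g b x z u) = 1 := by
                simp only [hI]; exact if_pos ⟨hB, hP, h3⟩
              rw [this]
              have h5 := hU0 a (step g b x z u)
              split_ifs <;> linarith
            -- Not being stuck gives `r ^ 2 * quotLaw < slopeLaw n ≤ (1 / r) ^ n`, so a slope law at
            -- time `n + 1` above `(1 / r) ^ (n + 1)` exceeds `r * quotLaw`: the Markov exception.
            · have h5 : r * quotLaw g b n (u.1 / g z) <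
                  slopeLaw g b (n + 1) (g x * u.1 / g z) := by
                push Not at h2 h3
                have e1 : (1 / r) ^ (n + 1) < slopeLaw g b (n + 1) (g x * u.1 / g z) := h3
                refine lt_of_le_of_lt ?_ e1
                rw [pow_succ, mul_one_div, le_div_iff₀ hr0]
                calc _ = r ^ 2 * quotLaw g b n (u.1 / g z) := by ring
                  _ ≤ _ := h2.le.trans hslope
              rw [if_pos h5]
              have h6 := hU0 a (step g b x z u)
              have h4 := hI0 (D a) (step g b x z u)
              split_ifs <;> linarith
          have h1 : α a u * ρ ≤ α a u * (stepMean g b (U a) u + S u + T u)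
              + α a u * stepMean g b (I (D a)) u := by
            rw [← mul_add]; exact mul_le_mul_of_nonneg_left hmean (hα0 a u)
          have h2 : α a u * (stepMean g b (U a) u + S u + T u)
              ≤ law g b n u * (stepMean g b (U a) u + S u + T u) :=
            mul_le_mul_of_nonneg_right (hαl a u)
              (add_nonneg (add_nonneg hU' (hS0 u)) (hT0 u))
          linarith
      have hSle : ∑ u, law g b n u * S u ≤ δ' := hstuck n (by omega)
      have hTle : ∑ u, law g b n u * T u ≤ 1 / r := markov_slope g b hg n r hr0
      have hUle : ∑ a ∈ B, ∑ u, law g b n u * stepMean g b (U a) u ≤ B.card * η := by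
        simp_rw [← sum_law_succ]
        exact hunpop (n + 1)
      calc (B.card : ℝ) * (ρ ^ (n + 1) - ((n + 1 : ℕ) : ℝ) * (η + δ' + 1 / r))
          ≤ ρ * (B.card * (ρ ^ n - n * (η + δ' + 1 / r))) - B.card * η - B.card * δ'
              - B.card * (1 / r) := by
            -- Earlier losses are only multiplied by `ρ ≤ 1`, so the losses add up linearly in time.
            have e : (0 : ℝ) ≤ B.card * (n * (η + δ' + 1 / r)) * (1 - ρ) := by
              have := sub_nonneg.2 hρ1
              positivity
            push_cast
            rw [pow_succ]
            nlinarith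
        _ ≤ (∑ a ∈ B, ∑ u, α a u) * ρ - ∑ a ∈ B, ∑ u, law g b n u * stepMean g b (U a) u
              - ∑ _a ∈ B, ∑ u, law g b n u * S u - ∑ _a ∈ B, ∑ u, law g b n u * T u := by
            have e1 := mul_le_mul_of_nonneg_left hαm hρ.le
            have e2 := mul_le_mul_of_nonneg_left hSle (Nat.cast_nonneg (α := ℝ) B.card)
            have e3 := mul_le_mul_of_nonneg_left hTle (Nat.cast_nonneg (α := ℝ) B.card)
            simp only [sum_const, nsmul_eq_mul]
            linarith
        _ = ∑ a ∈ B, ∑ u, (α a u * ρ - law g b n u * stepMean g b (U a) u - law g b n u * S u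
              - law g b n u * T u) := by
            simp only [sum_sub_distrib, sum_mul]
        _ ≤ ∑ a ∈ B, ∑ u, α a u * stepMean g b (I (D a)) u :=
            sum_le_sum fun a ha => sum_le_sum fun u _ => hpt a ha u
        _ = _ := sum_congr rfl fun a _ => (hsum a).symm

/-- The walk gets stuck at some time, since its slopes cannot spread beyond the field. -/
theorem exists_stuckMass_gt [Nonempty ι] (hg : ∀ x, g x ≠ 0) (B : Finset F) (hB : B.Nonempty)
    (ρ η δ δ' r : ℝ) (hρ : 0 < ρ) (hρ1 : ρ ≤ 1) (hδ1 : δ ≤ 1) (hr : 1 ≤ r) (hδ' : 0 ≤ δ')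
    (hη : 0 ≤ η)
    (hdeg : ∀ a ∈ B, ρ * (Fintype.card ι : ℝ) ^ 2 ≤
      ∑ x, ∑ z, if (g x * a + b x - b z) / g z ∈ B then (1 : ℝ) else 0)
    (hunpop : ∀ n, ∑ a ∈ B, ∑ v, law g b n v *
      (if v.1 * a + v.2 ∈ B ∧ ¬ Popular g b δ n v then (1 : ℝ) else 0) ≤ B.card * η)
    (J : ℕ) (hJ : Fintype.card F * (1 / r) ^ J < ρ ^ J - J * (η + δ' + 1 / r)) :
    ∃ n < J, δ' < stuckMass g b δ r n := by
  by_contra! hcon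
  obtain ⟨α, hα0, hαl, hαs, hαm⟩ := exists_alive_mass g b hg B ρ η δ δ' r hρ hρ1 hδ1 hr hδ' hη
    hdeg hunpop J hcon J le_rfl
  have hr0 : 0 < r := by linarith
  have hBpos : (0 : ℝ) < B.card := by exact_mod_cast hB.card_pos
  -- There are only `|F|` slopes, and each one carrying surviving mass has total mass at most `(1 /
  -- r) ^ J`.
  have hup : ∀ a ∈ B, ∑ v, α a v ≤ Fintype.card F * (1 / r) ^ J := by
    intro a ha
    set f : F → ℝ := fun s => if slopeLaw g b J s ≤ (1 / r) ^ J then 1 else 0 with hf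
    calc ∑ v, α a v ≤ ∑ v : F × F, law g b J v * f v.1 := by
          refine sum_le_sum fun v _ => ?_
          by_cases h : α a v = 0
          · rw [h]
            refine mul_nonneg (law_nonneg g b J v) ?_
            simp only [hf]; split_ifs <;> norm_num
          · have : f v.1 = 1 := if_pos (hαs a ha v h).2.2
            rw [this, mul_one]; exact hαl a v
      _ = ∑ s, slopeLaw g b J s * f s := sum_law_mul_slope g b J f
      _ ≤ ∑ _s : F, (1 / r) ^ J := by
          refine sum_le_sum fun s _ => ?_
          simp only [hf]
          split_ifs with h
          · simpa using h
          · rw [mul_zero]; positivity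
      _ = _ := by simp
  have h1 : ∑ a ∈ B, ∑ v, α a v ≤ B.card * (Fintype.card F * (1 / r) ^ J) := by
    rw [← nsmul_eq_mul]; exact sum_le_card_nsmul _ _ _ hup
  have h2 := mul_lt_mul_of_pos_left hJ hBpos
  linarith

/-- If the walk gets stuck, then for one quotient `k` many pairs of the given maps link the popular
maps of slope `k * g z` to those of slope `k * g x`. -/
theorem exists_slope_many_links [Nonempty ι] (hg : ∀ x, g x ≠ 0) (δ δ' r : ℝ) (hr : 0 < r) (n : ℕ)
    (h : δ' < stuckMass g b δ r n) :
    ∃ k : F, δ' / r ^ 2 * (Fintype.card ι : ℝ) ^ 2 ≤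
      ∑ x, ∑ z, ∑ c, if Popular g b δ n (k * g z, c) ∧
        Popular g b δ (n + 1) (k * g x, (g x * c + b x - b z) / g z) then (1 : ℝ) else 0 := by
  have hN : (0 : ℝ) < Fintype.card ι := by exact_mod_cast Fintype.card_pos
  by_contra! hcon
  refine absurd h (not_lt.2 ?_)
  set Cnt : F → ℝ := fun k => ∑ x, ∑ z, ∑ c, if Popular g b δ n (k * g z, c) ∧
        Popular g b δ (n + 1) (k * g x, (g x * c + b x - b z) / g z) then (1 : ℝ) else 0 with hCnt
  unfold stuckMass
  simp_rw [← mul_div_assoc]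
  rw [← sum_div, div_le_iff₀ (by positivity)]
  -- After the substitution `s = k * g z`, a stuck step satisfies `law ≤ slopeLaw ≤ r ^ 2 * quotLaw
  -- k`. The stuck mass is thus at most `r ^ 2` times the `quotLaw`-average of the normalised link
  -- counts, and some `k` does at least as well as the average.
  set f : ι → ι → F → F → ℝ := fun x z s c => law g b n (s, c) *
    (if Popular g b δ n (s, c) ∧ Popular g b δ (n + 1) (step g b x z (s, c)) ∧
    slopeLaw g b n s ≤ r ^ 2 * quotLaw g b n (s / g z) then (1 : ℝ) else 0) with hf
  calc _ = ∑ x, ∑ z, ∑ s, ∑ c, f x z s c := by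
        simp_rw [mul_sum]
        rw [sum_comm]
        refine sum_congr rfl fun x _ => ?_
        rw [sum_comm]
        refine sum_congr rfl fun z _ => ?_
        rw [Fintype.sum_prod_type]
    _ = ∑ x, ∑ z, ∑ k, ∑ c, f x z (k * g z) c :=
        sum_congr rfl fun x _ => sum_congr rfl fun z _ =>
          sum_eq_sum_mul_right (hg z) (fun s => ∑ c, f x z s c)
    _ ≤ ∑ x, ∑ z, ∑ k, ∑ c, r ^ 2 * quotLaw g b n k * (if Popular g b δ n (k * g z, c) ∧
        Popular g b δ (n + 1) (k * g x, (g x * c + b x - b z) / g z) then (1 : ℝ) else 0) := by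
        refine sum_le_sum fun x _ => sum_le_sum fun z _ => sum_le_sum fun k _ =>
          sum_le_sum fun c _ => ?_
        have hz := hg z
        have hs : step g b x z (k * g z, c) = (k * g x, (g x * c + b x - b z) / g z) := by
          simp only [step, Prod.mk.injEq, and_true]
          field_simp
        have hq : 0 ≤ r ^ 2 * quotLaw g b n k :=
          mul_nonneg (sq_nonneg _) (quotLaw_nonneg g b n k)
        simp only [hf, hs, mul_div_cancel_right₀ _ hz]
        split_ifs with h1 h2 h2
        · rw [mul_one, mul_one]
          exact (law_le_slopeLaw g b n _ _).trans h1.2.2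
        · exact absurd ⟨h1.1, h1.2.1⟩ h2
        · rw [mul_zero, mul_one]; exact hq
        · rw [mul_zero, mul_zero]
    _ = ∑ k, r ^ 2 * quotLaw g b n k * Cnt k := by
        simp_rw [hCnt, mul_sum]
        rw [sum_congr rfl fun x _ => sum_comm, sum_comm]
    _ ≤ ∑ k, r ^ 2 * quotLaw g b n k * (δ' / r ^ 2 * (Fintype.card ι : ℝ) ^ 2) :=
        sum_le_sum fun k _ => mul_le_mul_of_nonneg_left (hcon k).le
          (mul_nonneg (sq_nonneg _) (quotLaw_nonneg g b n k))
    _ = δ' * (Fintype.card ι : ℝ) ^ 2 := by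
        rw [← sum_mul, ← mul_sum, sum_quotLaw g b hg]
        field_simp

end Growth

/-! ### Numerical inequalities for the choice of parameters. -/

section Budget

/-- Smallness condition of `unpopular_mass_le` with `ρ = 1 / Q`, `η = 1 / T ^ 2`, `δ = 1 / (T ^ 4 *
Q ^ 4)`. Over the denominator `T ^ 4 * Q ^ 5` it reduces to `2 * Q + 1 ≤ Q ^ 3`. -/
theorem unpopular_budget {a q N m s Q T r : ℝ} (hq : 0 < q) (hN : 0 < N) (hs : 0 ≤ s)
    (hm : m ≤ Q) (hQ : 6 ≤ Q) (hT : 1 ≤ T) (hr : 1 ≤ r) (hTr : T ^ 4 * Q ^ 5 ≤ r)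
    (haq : r ^ 8 * a ≤ q) (hsN : r ^ 8 * s ≤ N) :
    1 / (T ^ 4 * Q ^ 4) + (a / q + m * s / N) ≤ (1 / Q * (1 / T ^ 2)) ^ 2 := by
  have hQ0 : 0 < Q := by linarith
  have hr0 : 0 < r := by linarith
  have hT0 : 0 < T := by linarith
  have e1 : a / q ≤ 1 / r ^ 8 := by
    rw [div_le_div_iff₀ hq (by positivity)]
    linarith
  have e2 : m * s / N ≤ Q / r ^ 8 := by
    rw [div_le_div_iff₀ hN (by positivity)]
    calc m * s * r ^ 8 ≤ Q * s * r ^ 8 := by gcongr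
      _ = Q * (r ^ 8 * s) := by ring
      _ ≤ Q * N := by gcongr
  have e3 : (1 + Q) / r ^ 8 ≤ (1 + Q) / (T ^ 4 * Q ^ 5) := by
    have : r ≤ r ^ 8 := le_self_pow₀ hr (by norm_num)
    gcongr
    linarith
  have e4 : 1 / r ^ 8 + Q / r ^ 8 = (1 + Q) / r ^ 8 := by ring
  have e5 : 1 / (T ^ 4 * Q ^ 4) + (1 + Q) / (T ^ 4 * Q ^ 5) ≤ (1 / Q * (1 / T ^ 2)) ^ 2 := by
    rw [← sub_nonneg]
    have : (1 / Q * (1 / T ^ 2)) ^ 2 - (1 / (T ^ 4 * Q ^ 4) + (1 + Q) / (T ^ 4 * Q ^ 5))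
        = (Q ^ 3 - (2 * Q + 1)) / (T ^ 4 * Q ^ 5) := by
      field_simp
      ring
    rw [this]
    refine div_nonneg ?_ (by positivity)
    have h36 : 36 ≤ Q ^ 2 := by nlinarith
    nlinarith
  linarith

/-- Survival over `J` steps has probability `1 / T`, while the losses are at most `3 * J / T ^ 2`
and the ceiling at most `1 / T ^ 2`; so `3 * J + 1 < T` suffices, which is Bernoulli's inequality.
-/
theorem spread_budget {q Q T r : ℝ} {J : ℕ} (hQ : 6 ≤ Q) (hT : T = Q ^ J) (hJ : 1 ≤ J)
    (hr : 1 ≤ r) (hTr : T ^ 2 ≤ r) (hrq : r ≤ q) (hq : q ^ 2 ≤ r ^ J) :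
    q * (1 / r) ^ J < (1 / Q) ^ J - J * (1 / T ^ 2 + 1 / T ^ 2 + 1 / r) := by
  have hQ0 : 0 < Q := by linarith
  have hr0 : 0 < r := by linarith
  have hT0 : 0 < T := by rw [hT]; positivity
  have hT3 : 3 * (J : ℝ) + 1 < T := by
    have h1 : (1 : ℝ) + J * 5 ≤ (1 + 5) ^ J := one_add_mul_le_pow (by norm_num) J
    have h2 : ((1 : ℝ) + 5) ^ J ≤ T := by rw [hT]; gcongr; linarith
    have h3 : (1 : ℝ) ≤ J := by exact_mod_cast hJ
    linarith
  have hq0 : 0 < q := by linarith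
  have e1 : q * (1 / r) ^ J ≤ 1 / T ^ 2 := by
    rw [one_div, inv_pow, ← div_eq_mul_inv]
    calc q / r ^ J ≤ q / q ^ 2 := by gcongr
      _ = 1 / q := by field_simp
      _ ≤ 1 / T ^ 2 := by
        gcongr
        linarith
  have e2 : (1 / Q) ^ J = 1 / T := by rw [hT, one_div, inv_pow, one_div]
  have e3 : (J : ℝ) * (1 / T ^ 2 + 1 / T ^ 2 + 1 / r) ≤ J * (3 / T ^ 2) := by
    refine mul_le_mul_of_nonneg_left ?_ (Nat.cast_nonneg J)
    have h1 : (3 : ℝ) / T ^ 2 = 1 / T ^ 2 + 1 / T ^ 2 + 1 / T ^ 2 := by ring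
    have h2 : 1 / r ≤ 1 / T ^ 2 := by gcongr
    linarith
  have e4 : 1 / T ^ 2 + J * (3 / T ^ 2) < 1 / T := by
    rw [← sub_pos]
    have : 1 / T - (1 / T ^ 2 + J * (3 / T ^ 2)) = (T - (3 * J + 1)) / T ^ 2 := by
      field_simp
      ring
    rw [this]
    exact div_pos (by linarith) (by positivity)
  rw [e2]
  linarith

/-- For list length `L = T ^ 4 * Q ^ 4` and link density `θ = 1 / (T ^ 2 * r ^ 2)`, pairs of equal
slope are negligible. -/
theorem link_budget {N m Q T r : ℝ} (hm : m ≤ Q) (hQ : 6 ≤ Q) (hT : 0 < T) (hr : 1 ≤ r)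
    (hTr : T ^ 20 * Q ^ 18 ≤ r) (hN : r ^ 8 ≤ N) :
    2 * m * (T ^ 4 * Q ^ 4) ^ 4 < (1 / T ^ 2 / r ^ 2) ^ 2 * N := by
  have hQ0 : 0 < Q := by linarith
  have hr0 : 0 < r := by linarith
  have e1 : (1 / T ^ 2 / r ^ 2) ^ 2 * N = N / (T ^ 4 * r ^ 4) := by
    field_simp
  rw [e1, lt_div_iff₀ (by positivity)]
  calc 2 * m * (T ^ 4 * Q ^ 4) ^ 4 * (T ^ 4 * r ^ 4)
      ≤ 2 * Q * (T ^ 4 * Q ^ 4) ^ 4 * (T ^ 4 * r ^ 4) := by gcongr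
    _ = 2 * (T ^ 20 * Q ^ 17) * r ^ 4 := by ring
    _ < Q * (T ^ 20 * Q ^ 17) * r ^ 4 := by gcongr; linarith
    _ = (T ^ 20 * Q ^ 18) * r ^ 4 := by ring
    _ ≤ r * r ^ 4 := by gcongr
    _ = r ^ 5 := by ring
    _ ≤ r ^ 8 := pow_le_pow_right₀ hr (by norm_num)
    _ ≤ N := hN

theorem line_budget {N Q T r : ℝ} (hQ : 6 ≤ Q) (hT : 0 < T) (hr : 1 ≤ r) (hN : 0 ≤ N)
    (hTr : T ^ 16 * Q ^ 13 ≤ r) :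
    N / r ^ 8 ≤ (1 / T ^ 2 / r ^ 2) ^ 2 * N / (2 * (T ^ 4 * Q ^ 4) ^ 3) := by
  have hQ0 : 0 < Q := by linarith
  have hr0 : 0 < r := by linarith
  have e1 : (1 / T ^ 2 / r ^ 2) ^ 2 * N / (2 * (T ^ 4 * Q ^ 4) ^ 3)
      = N / (2 * (T ^ 16 * Q ^ 12) * r ^ 4) := by
    field_simp
  rw [e1]
  refine div_le_div_of_nonneg_left hN (by positivity) ?_
  calc 2 * (T ^ 16 * Q ^ 12) * r ^ 4 ≤ Q * (T ^ 16 * Q ^ 12) * r ^ 4 := by gcongr; linarith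
    _ = (T ^ 16 * Q ^ 13) * r ^ 4 := by ring
    _ ≤ r * r ^ 4 := by gcongr
    _ = r ^ 5 := by ring
    _ ≤ r ^ 8 := pow_le_pow_right₀ hr (by norm_num)

end Budget

/-! ### From a small image to many collinear points `(g x, b x)`. -/

section Line

variable {F ι : Type*} [Field F] [Fintype ι] (g b : ι → F)

/-- If all maps `y ↦ g x * y + b x` send `A` into a set not much larger than `A`, then some subset
of `A` has large minimum degree for the steps of the walk. -/
theorem exists_subset_steps [Nonempty ι] (hg : ∀ x, g x ≠ 0) (A B : Finset F) (hA : A.Nonempty)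
    (hmap : ∀ x, ∀ a ∈ A, g x * a + b x ∈ B) (K : ℝ) (hK : (B.card : ℝ) ≤ K * A.card) :
    ∃ A' ⊆ A, A'.Nonempty ∧ ∀ a ∈ A', 1 / (4 * K) * (Fintype.card ι : ℝ) ^ 2 ≤
      ∑ x, ∑ z, if (g x * a + b x - b z) / g z ∈ A' then (1 : ℝ) else 0 := by
  have hN : (0 : ℝ) < Fintype.card ι := by exact_mod_cast Fintype.card_pos
  have hApos : (0 : ℝ) < A.card := by exact_mod_cast hA.card_pos
  have hBpos : (0 : ℝ) < B.card := by
    obtain ⟨a, ha⟩ := hA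
    exact_mod_cast card_pos.2 ⟨_, hmap (Classical.arbitrary ι) a ha⟩
  have hK0 : 0 < K := by
    by_contra! h
    nlinarith
  set c : F → F → ℝ := fun a a' => ∑ x, ∑ z, if g x * a + b x = g z * a' + b z then 1 else 0
    with hc
  have hsymm : ∀ a a', c a a' = c a' a := by
    intro a a'
    simp only [hc]
    rw [sum_comm]
    simp only [eq_comm]
  have hnn : ∀ a a', 0 ≤ c a a' := by
    intro a a'
    exact sum_nonneg fun _ _ => sum_nonneg fun _ _ => by split_ifs <;> norm_num
  -- Cauchy–Schwarz over the values in `B`: the `|ι| * |A|` evaluations collide at least `(|ι| *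
  -- |A|) ^ 2 / |B|` times.
  have hsum : (Fintype.card ι : ℝ) ^ 2 / K * A.card ≤ ∑ a ∈ A, ∑ a' ∈ A, c a a' := by
    set R : F → ℝ := fun u => ∑ a ∈ A, ∑ x, if g x * a + b x = u then 1 else 0 with hR
    have h1 : ∑ u ∈ B, R u = A.card * Fintype.card ι := by
      simp only [hR]
      rw [sum_comm]
      rw [← nsmul_eq_mul, ← sum_const]
      refine sum_congr rfl fun a ha => ?_
      rw [sum_comm]
      calc _ = ∑ _x : ι, (1 : ℝ) := by
            refine sum_congr rfl fun x _ => ?_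
            rw [sum_ite_eq, if_pos (hmap x a ha)]
        _ = _ := by simp
    have h2 : ∑ u ∈ B, R u ^ 2 = ∑ a ∈ A, ∑ a' ∈ A, c a a' := by
      have : ∀ u, R u ^ 2 = ∑ a ∈ A, ∑ a' ∈ A, ∑ x, ∑ z, (if g x * a + b x = u then (1 : ℝ) else 0)
          * if g z * a' + b z = u then 1 else 0 := by
        intro u
        simp only [hR, sq]
        rw [sum_mul_sum]
        exact sum_congr rfl fun a _ => sum_congr rfl fun a' _ => sum_mul_sum _ _ _ _
      simp_rw [this]
      rw [sum_comm]
      refine sum_congr rfl fun a ha => ?_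
      rw [sum_comm]
      refine sum_congr rfl fun a' _ => ?_
      rw [sum_comm]
      refine sum_congr rfl fun x _ => ?_
      rw [sum_comm]
      refine sum_congr rfl fun z _ => ?_
      simp only [ite_mul, one_mul, zero_mul]
      rw [sum_ite_eq, if_pos (hmap x a ha)]
      simp only [eq_comm]
    have h3 : (∑ u ∈ B, R u) ^ 2 ≤ B.card * ∑ u ∈ B, R u ^ 2 := sq_sum_le_card_mul_sum_sq
    rw [h1, h2] at h3
    have hs : 0 ≤ ∑ a ∈ A, ∑ a' ∈ A, c a a' := sum_nonneg fun _ _ => sum_nonneg fun _ _ =>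
      sum_nonneg fun _ _ => sum_nonneg fun _ _ => by split_ifs <;> norm_num
    have h4 := h3.trans (mul_le_mul_of_nonneg_right hK hs)
    rw [div_mul_eq_mul_div, div_le_iff₀ hK0]
    refine le_of_mul_le_mul_left ?_ hApos
    nlinarith
  obtain ⟨A', hA', hne, hdeg⟩ := exists_subset_le_degree c hsymm hnn A
    ((Fintype.card ι : ℝ) ^ 2 / K) (by positivity) hA hsum
  refine ⟨A', hA', hne, fun a ha => ?_⟩
  have h1 := hdeg a ha
  have h2 : ∑ a' ∈ A', c a a' =
      ∑ x, ∑ z, if (g x * a + b x - b z) / g z ∈ A' then (1 : ℝ) else 0 := by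
    simp only [hc]
    rw [sum_comm]
    refine sum_congr rfl fun x _ => ?_
    rw [sum_comm]
    refine sum_congr rfl fun z _ => ?_
    have : ∀ a', (g x * a + b x = g z * a' + b z) ↔ a' = (g x * a + b x - b z) / g z := by
      intro a'
      rw [eq_div_iff (hg z)]
      constructor
      · intro h; linear_combination -h
      · intro h; linear_combination -h
    simp_rw [this]
    rw [sum_ite_eq']
  rw [← h2]
  refine le_trans (le_of_eq ?_) h1
  field_simp

variable [Fintype F]

/-- Many links between short lists force many of the points `(g x, b x)` onto one line. -/
theorem exists_line_of_links [Nonempty ι] (hg : ∀ x, g x ≠ 0) (m L θ : ℝ)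
    (hm : ∀ s, ((univ.filter fun x => g x = s).card : ℝ) ≤ m) (P Q : ι → F → Prop)
    (hL : 0 < L) (hθ : 0 < θ)
    (hP : ∀ z, ((univ.filter fun c => P z c).card : ℝ) ≤ L)
    (hQ : ∀ x, ((univ.filter fun c => Q x c).card : ℝ) ≤ L)
    (hE : θ * (Fintype.card ι : ℝ) ^ 2 ≤
      ∑ x, ∑ z, ∑ c, if P z c ∧ Q x ((g x * c + b x - b z) / g z) then (1 : ℝ) else 0)
    (hN : 2 * m * L ^ 4 < θ ^ 2 * Fintype.card ι) :
    ∃ c d : F, θ ^ 2 * Fintype.card ι / (2 * L ^ 3) ≤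
      ((univ.filter fun x => b x = c * g x + d).card : ℝ) := by
  set N : ℝ := (Fintype.card ι : ℝ) with hNdef
  have hN0 : 0 < N := by rw [hNdef]; exact_mod_cast Fintype.card_pos
  have hm0 : 0 ≤ m := (Nat.cast_nonneg _).trans (hm 0)
  set X : Finset (ι × F) := univ.filter fun y => Q y.1 y.2 with hX
  set Z : Finset (ι × F) := univ.filter fun w => P w.1 w.2 with hZ
  set e : ι × F → ι × F → ℝ := fun y w =>
    if g y.1 * w.2 + b y.1 = g w.1 * y.2 + b w.1 then 1 else 0 with he
  have he0 : ∀ y w, 0 ≤ e y w := fun y w => by simp only [he]; split_ifs <;> norm_num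
  have he1 : ∀ y w, e y w ≤ 1 := fun y w => by simp only [he]; split_ifs <;> norm_num
  have hcard : ∀ (R : ι → F → Prop), (∀ x, ((univ.filter fun c => R x c).card : ℝ) ≤ L) →
      ∀ p : ι → Prop, ((univ.filter fun y : ι × F => R y.1 y.2 ∧ p y.1).card : ℝ)
        ≤ (univ.filter fun x => p x).card * L := by
    intro R hR p
    rw [card_filter, Fintype.sum_prod_type]
    push_cast
    rw [← sum_filter_add_sum_filter_not univ p]
    rw [sum_eq_zero (s := univ.filter fun x => ¬ p x)]
    · rw [add_zero, ← nsmul_eq_mul]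
      refine sum_le_card_nsmul _ _ _ fun x hx => ?_
      refine le_trans (le_of_eq ?_) (hR x)
      rw [card_filter]
      push_cast
      refine sum_congr rfl fun c _ => ?_
      simp [(mem_filter.1 hx).2]
    · intro x hx
      exact sum_eq_zero fun c _ => if_neg fun h => (mem_filter.1 hx).2 h.2
  have hXc : (X.card : ℝ) ≤ N * L := by
    simpa [hX, hNdef] using hcard Q hQ (fun _ => True)
  have hZc : (Z.card : ℝ) ≤ N * L := by
    simpa [hZ, hNdef] using hcard P hP (fun _ => True)
  have hE' : θ * N ^ 2 ≤ ∑ y ∈ X, ∑ w ∈ Z, e y w := by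
    refine hE.trans ?_
    have h1 : ∑ y ∈ X, ∑ w ∈ Z, e y w = ∑ x, ∑ z, ∑ c, ∑ d,
        if (Q x d ∧ P z c) ∧ g x * c + b x = g z * d + b z then (1 : ℝ) else 0 := by
      rw [hX, sum_filter, Fintype.sum_prod_type]
      refine sum_congr rfl fun x _ => ?_
      rw [sum_congr rfl fun z _ => sum_comm, sum_comm]
      refine sum_congr rfl fun d _ => ?_
      rw [hZ, sum_filter, Fintype.sum_prod_type]
      by_cases hQd : Q x d
      · simp only [hQd, if_true, true_and, he]
        exact sum_congr rfl fun z _ => sum_congr rfl fun c _ => (ite_and _ _ _ _).symm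
      · simp [hQd]
    rw [h1]
    refine sum_le_sum fun x _ => sum_le_sum fun z _ => sum_le_sum fun c _ => ?_
    refine le_trans ?_ (single_le_sum (f := fun d => if (Q x d ∧ P z c) ∧
      g x * c + b x = g z * d + b z then (1 : ℝ) else 0)
      (fun d _ => by split_ifs <;> norm_num)
      (mem_univ ((g x * c + b x - b z) / g z)))
    have hz := hg z
    have : g x * c + b x = g z * ((g x * c + b x - b z) / g z) + b z := by field_simp; ring
    simp only [← this, and_true]
    split_ifs with h1 h2
    · exact le_rfl
    · exact absurd h1.symm h2
    · exact zero_le_one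
    · exact le_rfl
  set T : ℝ := θ ^ 2 * N / (2 * L ^ 3) with hT
  have hT0 : 0 ≤ T := by positivity
  -- Cauchy–Schwarz on the link graph between `X` and `Z` gives many common neighbours on average.
  -- Pairs with equal slope are few since fibres of `g` have size at most `m`, and `hN` makes them
  -- negligible.
  obtain ⟨w₁, w₂, hne, hco⟩ : ∃ w₁ w₂ : ι × F, g w₁.1 ≠ g w₂.1 ∧
      T ≤ ∑ y ∈ X, e y w₁ * e y w₂ := by
    by_contra! hcon
    have hcs : (∑ y ∈ X, ∑ w ∈ Z, e y w) ^ 2 ≤ X.card * ∑ y ∈ X, (∑ w ∈ Z, e y w) ^ 2 :=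
      sq_sum_le_card_mul_sum_sq
    have hexp : ∑ y ∈ X, (∑ w ∈ Z, e y w) ^ 2 = ∑ w₁ ∈ Z, ∑ w₂ ∈ Z, ∑ y ∈ X, e y w₁ * e y w₂ := by
      simp_rw [sq, sum_mul_sum]
      rw [sum_comm]
      exact sum_congr rfl fun _ _ => sum_comm
    have hpair : ∀ w₁ w₂ : ι × F, ∑ y ∈ X, e y w₁ * e y w₂ ≤
        T + if g w₂.1 = g w₁.1 then N * L else 0 := by
      intro w₁ w₂
      split_ifs with h
      · have : ∑ y ∈ X, e y w₁ * e y w₂ ≤ X.card := by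
          calc _ ≤ ∑ _y ∈ X, (1 : ℝ) :=
                sum_le_sum fun y _ => mul_le_one₀ (he1 _ _) (he0 _ _) (he1 _ _)
            _ = _ := by simp
        linarith
      · rw [add_zero]; exact (hcon w₁ w₂ (Ne.symm h)).le
    have hdeg : ∀ w₁ : ι × F, ∑ w₂ ∈ Z, (if g w₂.1 = g w₁.1 then N * L else 0)
        ≤ m * L * (N * L) := by
      intro w₁
      rw [← sum_filter, sum_const, nsmul_eq_mul]
      refine mul_le_mul_of_nonneg_right ?_ (by positivity)
      rw [hZ, filter_filter]
      refine (hcard P hP fun x => g x = g w₁.1).trans ?_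
      exact mul_le_mul_of_nonneg_right (hm _) hL.le
    have hsum : ∑ y ∈ X, (∑ w ∈ Z, e y w) ^ 2 ≤ N * L * (N * L * T + m * L * (N * L)) := by
      rw [hexp]
      calc _ ≤ ∑ w₁ ∈ Z, ∑ w₂ ∈ Z, (T + if g w₂.1 = g w₁.1 then N * L else 0) :=
            sum_le_sum fun _ _ => sum_le_sum fun _ _ => hpair _ _
        _ ≤ ∑ _w₁ ∈ Z, (N * L * T + m * L * (N * L)) := by
            refine sum_le_sum fun w₁ _ => ?_
            rw [sum_add_distrib, sum_const, nsmul_eq_mul]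
            exact add_le_add (mul_le_mul_of_nonneg_right hZc hT0) (hdeg w₁)
        _ ≤ _ := by
            rw [sum_const, nsmul_eq_mul]
            exact mul_le_mul_of_nonneg_right hZc (by positivity)
    have h2 : (θ * N ^ 2) ^ 2 ≤ N * L * (N * L * (N * L * T + m * L * (N * L))) := by
      calc (θ * N ^ 2) ^ 2 ≤ (∑ y ∈ X, ∑ w ∈ Z, e y w) ^ 2 := by gcongr
        _ ≤ X.card * ∑ y ∈ X, (∑ w ∈ Z, e y w) ^ 2 := hcs
        _ ≤ _ := mul_le_mul hXc hsum (sum_nonneg fun _ _ => sq_nonneg _) (by positivity)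
    have h3 : N * L * (N * L * (N * L * T + m * L * (N * L)))
        = N ^ 3 * (θ ^ 2 * N / 2 + m * L ^ 4) := by
      rw [hT]; field_simp
    rw [h3] at h2
    have h4 : N ^ 3 * (θ ^ 2 * N / 2 + m * L ^ 4) < N ^ 3 * (θ ^ 2 * N) :=
      mul_lt_mul_of_pos_left (by linarith) (by positivity)
    nlinarith
  have hsub : g w₂.1 - g w₁.1 ≠ 0 := sub_ne_zero.2 hne.symm
  -- A common neighbour `(x, d)` satisfies two linear equations; eliminating `d` leaves `b x` as an
  -- affine function of `g x`. Conversely `x` determines `d`, so distinct neighbours give distinct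
  -- `x`.
  refine ⟨-(g w₂.1 * w₁.2 - g w₁.1 * w₂.2) / (g w₂.1 - g w₁.1),
    (g w₂.1 * b w₁.1 - g w₁.1 * b w₂.1) / (g w₂.1 - g w₁.1), hco.trans ?_⟩
  have hcount : ∑ y ∈ X, e y w₁ * e y w₂ = ((X.filter fun y =>
      g y.1 * w₁.2 + b y.1 = g w₁.1 * y.2 + b w₁.1 ∧
      g y.1 * w₂.2 + b y.1 = g w₂.1 * y.2 + b w₂.1).card : ℝ) := by
    rw [card_filter]
    push_cast
    refine sum_congr rfl fun y _ => ?_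
    simp only [he]
    rw [ite_and, ite_mul, one_mul, zero_mul]
  rw [hcount]
  norm_cast
  refine card_le_card_of_injOn (fun y => y.1) ?_ ?_
  · intro y hy
    obtain ⟨h1, h2⟩ := (mem_filter.1 (mem_coe.1 hy)).2
    simp only [coe_filter, mem_univ, true_and, Set.mem_ofPred_eq]
    field_simp
    linear_combination g w₂.1 * h1 - g w₁.1 * h2
  · intro y hy y' hy' hyy
    obtain ⟨h1, -⟩ := (mem_filter.1 (mem_coe.1 hy)).2
    obtain ⟨h1', -⟩ := (mem_filter.1 (mem_coe.1 hy')).2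
    simp only at hyy
    rw [hyy] at h1
    have h3 : g w₁.1 * y.2 = g w₁.1 * y'.2 := by linear_combination h1' - h1
    exact Prod.ext hyy (mul_left_cancel₀ (hg _) h3)

/-- A family of affine maps with many slopes, all of which send a set `A` into a set not much larger
than `A`, has many members through a common point: the points `(g x, b x)` are often collinear. -/
theorem exists_line [Nonempty ι] (hg : ∀ x, g x ≠ 0) (A B : Finset F) (hA : A.Nonempty)
    (hmap : ∀ x, ∀ a ∈ A, g x * a + b x ∈ B) (K m Q r : ℝ) (J : ℕ)
    (hm : ∀ s, ((univ.filter fun x => g x = s).card : ℝ) ≤ m)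
    (hK : (B.card : ℝ) ≤ K * A.card) (hKQ : 4 * K ≤ Q) (hmQ : m ≤ Q) (hQ : 6 ≤ Q) (hr : 1 ≤ r)
    (hJ : (Fintype.card F : ℝ) ^ 2 ≤ r ^ J) (hQr : Q ^ (20 * J + 20) ≤ r)
    (hN : r ^ 8 * √(Fintype.card F) ≤ Fintype.card ι) (hAF : r ^ 8 * A.card ≤ Fintype.card F) :
    ∃ c d : F, Fintype.card ι / r ^ 8 ≤
      ((univ.filter fun x => b x = c * g x + d).card : ℝ) := by
  obtain ⟨A', hA', hne, hdeg⟩ := exists_subset_steps g b hg A B hA hmap K hK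
  have hN0 : (0 : ℝ) < Fintype.card ι := by exact_mod_cast Fintype.card_pos
  have hq2 : (2 : ℝ) ≤ Fintype.card F := by exact_mod_cast Fintype.one_lt_card
  have hApos : (1 : ℝ) ≤ A.card := by exact_mod_cast hA.card_pos
  have hBpos : (0 : ℝ) < B.card := by
    obtain ⟨a, ha⟩ := hA
    exact_mod_cast card_pos.2 ⟨_, hmap (Classical.arbitrary ι) a ha⟩
  have hK0 : 0 < K := by
    by_contra! h
    nlinarith
  have hQ0 : 0 < Q := by linarith
  have hr0 : 0 < r := by linarith
  have hJ1 : 1 ≤ J := by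
    by_contra! h
    have : J = 0 := by omega
    rw [this, pow_zero] at hJ
    nlinarith
  -- `1 / T` is the survival probability `ρ ^ J` for `ρ = 1 / Q`. The hypothesis `hQr` says `T ^ 20
  -- * Q ^ 20 ≤ r`, which covers every monomial used.
  obtain ⟨T, hT⟩ : ∃ T, T = Q ^ J := ⟨_, rfl⟩
  have hT1 : 1 ≤ T := hT ▸ one_le_pow₀ (by linarith)
  have hTpos : 0 < T := by linarith
  have hpow : ∀ i j : ℕ, i ≤ 20 → j ≤ 20 → T ^ i * Q ^ j ≤ r := fun i j hi hj =>
    (mul_le_mul (pow_le_pow_right₀ hT1 hi) (pow_le_pow_right₀ (by linarith) hj)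
      (by positivity) (by positivity)).trans
      (by rwa [hT, ← pow_mul, ← pow_add, mul_comm J])
  have hr8 : r ≤ r ^ 8 := le_self_pow₀ hr (by norm_num)
  have hrq : r ≤ Fintype.card F := by nlinarith [pow_pos hr0 8]
  have hT2 : T ^ 2 ≤ r := by simpa using hpow 2 0 (by norm_num) (by norm_num)
  have hN8 : r ^ 8 ≤ Fintype.card ι := by
    refine le_trans ?_ hN
    have : 1 ≤ √(Fintype.card F : ℝ) := Real.one_le_sqrt.2 (by linarith)
    nlinarith [pow_pos hr0 8]
  have hδ0 : 0 < 1 / (T ^ 4 * Q ^ 4) := by positivity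
  have hdeg' : ∀ a ∈ A', 1 / Q * (Fintype.card ι : ℝ) ^ 2 ≤
      ∑ x, ∑ z, if (g x * a + b x - b z) / g z ∈ A' then (1 : ℝ) else 0 := by
    intro a ha
    refine le_trans ?_ (hdeg a ha)
    gcongr
  have hA'F : r ^ 8 * A'.card ≤ Fintype.card F := by
    have : (A'.card : ℝ) ≤ A.card := by exact_mod_cast card_le_card hA'
    nlinarith [pow_pos hr0 8]
  have hunpop := unpopular_mass_le g b hg m hm A' (1 / Q) (1 / T ^ 2) (1 / (T ^ 4 * Q ^ 4))
    (by positivity) (by positivity) hδ0 hdeg'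
    (unpopular_budget (by linarith) hN0 (Real.sqrt_nonneg _) hmQ hQ hT1 hr
      (hpow 4 5 (by norm_num) (by norm_num)) hA'F hN)
  obtain ⟨n, -, hstuck⟩ := exists_stuckMass_gt g b hg A' hne (1 / Q) (1 / T ^ 2)
    (1 / (T ^ 4 * Q ^ 4)) (1 / T ^ 2) r (by positivity)
    (by rw [div_le_one hQ0]; linarith)
    (by
      rw [div_le_one (by positivity)]
      exact one_le_mul_of_one_le_of_one_le (one_le_pow₀ hT1) (one_le_pow₀ (by linarith)))
    hr (by positivity) (by positivity) hdeg' hunpop J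
    (spread_budget hQ hT hJ1 hr hT2 hrq hJ)
  obtain ⟨k, hk⟩ := exists_slope_many_links g b hg _ (1 / T ^ 2) r hr0 n hstuck
  have hlist : ∀ n s, ((univ.filter fun c => Popular g b (1 / (T ^ 4 * Q ^ 4)) n (s, c)).card : ℝ)
      ≤ T ^ 4 * Q ^ 4 := by
    intro n s
    refine (card_popular_le g b hδ0 n s).trans_eq ?_
    rw [one_div_one_div]
  obtain ⟨c, d, hcd⟩ := exists_line_of_links g b hg m (T ^ 4 * Q ^ 4) (1 / T ^ 2 / r ^ 2) hm
    (fun z c => Popular g b _ n (k * g z, c)) (fun x c => Popular g b _ (n + 1) (k * g x, c))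
    (by positivity) (by positivity) (fun z => hlist n _) (fun x => hlist (n + 1) _) hk
    (link_budget hmQ hQ hTpos hr (hpow 20 18 (by norm_num) (by norm_num)) hN8)
  exact ⟨c, d, (line_budget hQ hTpos hr hN0.le
    (hpow 16 13 (by norm_num) (by norm_num))).trans hcd⟩

end Line

/-- Each term of the incidence bound is at most `n ^ 2 * a * (Q ^ 2 / r)`, less than half of the
right side: the first because `a * r ≤ q`, the second because `√q * r ≤ n`. -/
theorem two_centres_budget {q a x y n K m Q r : ℝ} (hq : 0 < q) (ha : 0 < a)
    (hy : 0 ≤ y) (hn : 0 < n) (hK : 0 ≤ K) (hm : 0 ≤ m) (hKQ : K ≤ Q) (hmQ : m ≤ Q)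
    (hxK : x ≤ K * a) (hyK : y ≤ K * a) (hr : 1 ≤ r) (hQr : 2 * Q ^ 2 < r) (haq : r ^ 8 * a ≤ q)
    (hqn : r ^ 8 * √q ≤ n) :
    x * y * n ^ 2 / q + √(q * (x * y)) * (m * n) < n ^ 2 * a := by
  have hr0 : 0 < r := by linarith
  have hr8 : r ≤ r ^ 8 := le_self_pow₀ hr (by norm_num)
  have hxy : x * y ≤ (K * a) ^ 2 := by
    rw [sq]
    exact mul_le_mul hxK hyK hy (by positivity)
  have t1 : x * y * n ^ 2 / q ≤ n ^ 2 * a * (Q ^ 2 / r) := by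
    rw [div_le_iff₀ hq]
    have e1 : a * r ≤ q := le_trans (by nlinarith) haq
    calc x * y * n ^ 2 ≤ (K * a) ^ 2 * n ^ 2 := by gcongr
      _ = n ^ 2 * a * (K ^ 2 / r) * (a * r) := by field_simp
      _ ≤ n ^ 2 * a * (Q ^ 2 / r) * q := by gcongr
  have t2 : √(q * (x * y)) * (m * n) ≤ n ^ 2 * a * (Q ^ 2 / r) := by
    have e1 : √(q * (x * y)) ≤ √q * (K * a) := by
      rw [Real.sqrt_mul hq.le]
      refine mul_le_mul_of_nonneg_left ?_ (Real.sqrt_nonneg _)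
      exact (Real.sqrt_le_sqrt hxy).trans_eq (Real.sqrt_sq (by positivity))
    have e2 : √q * r ≤ n := le_trans (by nlinarith [Real.sqrt_nonneg q]) hqn
    have e3 : K * m ≤ Q ^ 2 := by
      rw [sq]; exact mul_le_mul hKQ hmQ hm (hK.trans hKQ)
    calc _ ≤ √q * (K * a) * (m * n) := by gcongr
      _ = n * a * ((K * m) / r) * (√q * r) := by field_simp
      _ ≤ n * a * (Q ^ 2 / r) * n := by gcongr
      _ = _ := by ring
  have hlt : Q ^ 2 / r < 1 / 2 := by
    rw [div_lt_div_iff₀ hr0 two_pos]; linarith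
  have hpos : 0 < n ^ 2 * a := by positivity
  nlinarith

/-! ### Two families with different centres. -/

section TwoFamilies

variable {F ι : Type*} [Field F] [Fintype F] [Fintype ι] (g b : ι → F)

/-- If the maps `y ↦ g x * y + b x` all take a common value and so do the maps
`y ↦ g x * y + b' x`, at different points, then the images of a set `A` under the two families
cannot both be small. -/
theorem card_mul_card_le_of_two_centres (hg : ∀ x, g x ≠ 0) (w : ι → F) (A B C : Finset F)
    (hB : ∀ x, ∀ a ∈ A, g x * a + b x ∈ B) (hC : ∀ x, ∀ a ∈ A, g x * a + (b x + w x) ∈ C)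
    (m : ℝ) (hm : ∀ s, ((univ.filter fun x => g x = s).card : ℝ) ≤ m)
    (c d c' d' : F) (hb : ∀ x, b x = c * g x + d) (hw : ∀ x, w x = c' * g x + d') (hc' : c' ≠ 0) :
    (Fintype.card ι : ℝ) ^ 2 * A.card ≤ B.card * C.card * (Fintype.card ι : ℝ) ^ 2 / Fintype.card F
      + √(Fintype.card F * (B.card * C.card)) * (m * Fintype.card ι) := by
  have hm0 : 0 ≤ m := (Nat.cast_nonneg _).trans (hm 0)
  -- For fixed indices `k`, the pairs of images of `a ∈ A` under map `k.1` of the first family and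
  -- `k.2` of the second lie on one line. At abscissa `d` it has height `c' * g k.2 + (d + d')`, so
  -- with `c' ≠ 0` the line determines `g k.2`, then `g k.1`: multiplicity at most `m ^ 2`.
  have key := incidence_le (F := F) (I := B × C) (κ := ι × ι)
    (fun i => ((i.1 : F), (i.2 : F)))
    (fun k => (g k.2 / g k.1, c' * g k.2 + (d + d') - g k.2 / g k.1 * d)) 1 (m ^ 2) zero_le_one ?_ ?_
  · have hlow : (Fintype.card ι : ℝ) ^ 2 * A.card ≤ ∑ i : B × C, ∑ k : ι × ι,
        if (i.2 : F) = g k.2 / g k.1 * (i.1 : F) + (c' * g k.2 + (d + d') - g k.2 / g k.1 * d)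
          then (1 : ℝ) else 0 := by
      rw [sum_comm]
      calc (Fintype.card ι : ℝ) ^ 2 * A.card = ∑ _k : ι × ι, (A.card : ℝ) := by simp [sq]
        _ ≤ _ := by
          refine sum_le_sum fun k _ => ?_
          rw [← sum_filter, sum_const, nsmul_eq_mul, mul_one]
          norm_cast
          rw [← card_attach]
          refine card_le_card_of_injOn (fun a => (⟨g k.1 * a + b k.1, hB k.1 a a.2⟩,
            ⟨g k.2 * a + (b k.2 + w k.2), hC k.2 a a.2⟩)) ?_ ?_
          · intro a _
            simp only [coe_filter, mem_univ, true_and, Set.mem_ofPred_eq]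
            have h1 := hg k.1
            rw [hb, hb, hw]
            field_simp
            ring
          · intro a _ a' _ haa
            have h1 := congrArg (fun i : B × C => (i.1 : F)) haa
            simp only at h1
            exact Subtype.ext (mul_left_cancel₀ (hg k.1) (add_right_cancel h1))
    refine hlow.trans (key.trans (le_of_eq ?_))
    simp only [Fintype.card_prod, Fintype.card_coe, Nat.cast_mul]
    rw [show (Fintype.card F : ℝ) * 1 * m ^ 2 * (B.card * C.card) *
      (Fintype.card ι * Fintype.card ι) =
      Fintype.card F * (B.card * C.card) * (m * Fintype.card ι) ^ 2 by ring,
      Real.sqrt_mul (by positivity), Real.sqrt_sq (by positivity), sq]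
  · intro v
    norm_cast
    rw [card_le_one]
    intro i hi j hj
    simp only [mem_filter, mem_univ, true_and] at hi hj
    have h := hi.trans hj.symm
    exact Prod.ext (Subtype.ext (congrArg Prod.fst h)) (Subtype.ext (congrArg Prod.snd h))
  · intro v
    set s₂ : F := (v.2 - (d + d') + v.1 * d) / c' with hs₂
    have hsub : (univ.filter fun k : ι × ι =>
        (g k.2 / g k.1, c' * g k.2 + (d + d') - g k.2 / g k.1 * d) = v) ⊆
        (univ.filter fun x => g x = s₂ / v.1) ×ˢ (univ.filter fun x => g x = s₂) := by
      intro k hk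
      simp only [mem_filter, mem_univ, true_and] at hk
      have h1 := hg k.1
      have h2 := hg k.2
      have h3 : g k.2 = s₂ := by
        rw [hs₂, ← hk]
        field_simp
        ring
      have h4 : g k.1 = s₂ / v.1 := by
        rw [← h3, ← hk]
        field_simp
      simp [h3, h4]
    have hle : ((univ.filter fun k : ι × ι =>
        (g k.2 / g k.1, c' * g k.2 + (d + d') - g k.2 / g k.1 * d) = v).card : ℝ) ≤
        (univ.filter fun x => g x = s₂ / v.1).card * (univ.filter fun x => g x = s₂).card := by
      exact_mod_cast (card_le_card hsub).trans_eq (card_product _ _)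
    refine hle.trans ?_
    rw [sq]
    exact mul_le_mul (hm _) (hm _) (Nat.cast_nonneg _) hm0

theorem card_filter_subtype_le (p : ι → Prop) (S : ι → Prop) :
    (univ.filter fun x : {x // p x} => S x).card ≤ (univ.filter fun x => S x).card := by
  refine card_le_card_of_injOn (fun x => (x : ι)) ?_ ?_
  · intro x hx
    simpa using hx
  · intro x _ y _ h
    exact Subtype.ext h

/-- A family of affine maps with slopes `g x`, and its translates by a function `w` with small
fibres, cannot both send a set into a set of almost the same size. -/
theorem max_lt_card_of_two_families [Nonempty ι] (hg : ∀ x, g x ≠ 0) (w : ι → F)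
    (A B C : Finset F)
    (hA : A.Nonempty) (hB : ∀ x, ∀ a ∈ A, g x * a + b x ∈ B)
    (hC : ∀ x, ∀ a ∈ A, g x * a + (b x + w x) ∈ C)
    (K m Q r : ℝ) (J : ℕ)
    (hm : ∀ s, ((univ.filter fun x => g x = s).card : ℝ) ≤ m)
    (hw : ∀ s, ((univ.filter fun x => w x = s).card : ℝ) ≤ Q)
    (hKQ : 4 * K ≤ Q) (hmQ : m ≤ Q) (hQ : 6 ≤ Q) (hr : 1 ≤ r)
    (hJ : (Fintype.card F : ℝ) ^ 2 ≤ r ^ J) (hQr : Q ^ (20 * J + 20) ≤ r)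
    (hN : r ^ 24 * √(Fintype.card F) ≤ Fintype.card ι) (hAF : r ^ 8 * A.card ≤ Fintype.card F) :
    K * A.card < max (B.card : ℝ) C.card := by
  by_contra! hcon
  obtain ⟨hBK, hCK⟩ := max_le_iff.1 hcon
  have hq1 : (1 : ℝ) ≤ Fintype.card F := by exact_mod_cast Fintype.card_pos
  have hq0 : (0 : ℝ) < Fintype.card F := by linarith
  have hsq : 1 ≤ √(Fintype.card F : ℝ) := Real.one_le_sqrt.2 hq1
  have hr0 : 0 < r := by linarith
  have hm0 : 0 ≤ m := (Nat.cast_nonneg _).trans (hm 0)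
  have hQ0 : 0 < Q := by linarith
  have hApos : (0 : ℝ) < A.card := by exact_mod_cast hA.card_pos
  have hK0 : 0 ≤ K := by
    by_contra! h
    have : (0 : ℝ) ≤ B.card := Nat.cast_nonneg _
    nlinarith
  have hr8 : r ≤ r ^ 8 := le_self_pow₀ hr (by norm_num)
  have hQr3 : 2 * Q ^ 2 < r := by
    have h1 : Q ^ 3 ≤ r := (pow_le_pow_right₀ (by linarith) (by omega)).trans hQr
    nlinarith [pow_pos hQ0 2]
  -- Each use of `exists_line` costs a factor `r ^ 8` in the number of indices; starting from `r ^
  -- 24 * √q`, two uses leave the `r ^ 8 * √q` needed at the end.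
  obtain ⟨c, d, h1⟩ := exists_line g b hg A B hA hB K m Q r J hm hBK hKQ hmQ hQ hr hJ hQr
    (le_trans (by gcongr; norm_num) hN) hAF
  set p₁ : ι → Prop := fun x => b x = c * g x + d with hp₁
  have hX₁ : (Fintype.card ι : ℝ) / r ^ 8 ≤ Fintype.card {x // p₁ x} := by
    rw [Fintype.card_subtype]; exact h1
  have hX₁' : r ^ 16 * √(Fintype.card F : ℝ) ≤ Fintype.card {x // p₁ x} := by
    refine le_trans ?_ hX₁
    rw [le_div_iff₀ (by positivity)]
    linarith
  have hne₁ : Nonempty {x // p₁ x} := by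
    rw [← Fintype.card_pos_iff]
    have : (0 : ℝ) < Fintype.card {x // p₁ x} := lt_of_lt_of_le (by positivity) hX₁'
    exact_mod_cast this
  obtain ⟨c', d', h2⟩ := exists_line (fun x : {x // p₁ x} => g x) (fun x => b x + w x)
    (fun x => hg x) A C hA (fun x => hC x) K m Q r J
    (fun s => le_trans (by exact_mod_cast card_filter_subtype_le p₁ fun x => g x = s) (hm s))
    hCK hKQ hmQ hQ hr hJ hQr (le_trans (by gcongr; norm_num) hX₁') hAF
  set p₂ : {x // p₁ x} → Prop := fun x => b x + w x = c' * g x + d' with hp₂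
  have hX₂ : r ^ 8 * √(Fintype.card F : ℝ) ≤ Fintype.card {x // p₂ x} := by
    rw [Fintype.card_subtype]
    refine le_trans ?_ h2
    rw [le_div_iff₀ (by positivity)]
    linarith
  have hQX : Q < Fintype.card {x // p₂ x} := by
    have : r ^ 8 ≤ Fintype.card {x // p₂ x} := le_trans (by nlinarith [pow_pos hr0 8]) hX₂
    nlinarith
  have hwX : ∀ x : {x // p₂ x}, w x = (c' - c) * g x + (d' - d) := by
    intro x
    have e1 : b x = c * g x + d := x.1.2
    have e2 : b x + w x = c' * g x + d' := x.2
    linear_combination e2 - e1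
  have hfib : ∀ S : ι → Prop, ((univ.filter fun x : {x // p₂ x} => S x).card : ℝ) ≤
      (univ.filter fun x => S x).card := by
    intro S
    exact_mod_cast (card_filter_subtype_le p₂ fun x => S x).trans (card_filter_subtype_le p₁ S)
  -- Otherwise `w` would be constant on more than `Q` indices.
  have hcc : c' - c ≠ 0 := by
    intro h0
    have h3 := (hfib fun x => w x = d' - d).trans (hw (d' - d))
    rw [filter_true_of_mem (fun x _ => by rw [hwX, h0]; ring), card_univ] at h3
    linarith
  have hfin := card_mul_card_le_of_two_centres (fun x : {x // p₂ x} => g x) (fun x => b x) (fun x => hg x)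
    (fun x => w x) A B C (fun x => hB x) (fun x => hC x) m
    (fun s => (hfib fun x => g x = s).trans (hm s)) c d (c' - c) (d' - d) (fun x => x.1.2) hwX hcc
  exact absurd hfin (not_le.2 (two_centres_budget hq0 hApos (Nat.cast_nonneg _)
    (hQ0.trans hQX) hK0 hm0 (by linarith) hmQ hBK hCK hr hQr3 hAF hX₂))

end TwoFamilies

end AffineWalk

/-! ### Choice of exponents and conclusion. -/

namespace AffineWalk

open Filter Finset

/-- The exponents used below: `r = p ^ τ` and `Q = p ^ γ`. -/
theorem exists_exponents (α : ℝ) (hα₁ : 1 / 2 < α) (hα₂ : α < 1) :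
    ∃ (τ γ : ℝ) (J : ℕ), 0 < τ ∧ 0 < γ ∧ γ ≤ 1 ∧ 2 ≤ τ * J ∧ γ * (20 * J + 20) = τ ∧
      1 / 2 + 24 * τ < α ∧ α + 8 * τ < 1 := by
  set σ := min (α - 1 / 2) (1 - α) with hσ
  have hσ0 : 0 < σ := lt_min (by linarith) (by linarith)
  have h1 : σ ≤ α - 1 / 2 := min_le_left _ _
  have h2 : σ ≤ 1 - α := min_le_right _ _
  have hJ0 : (0 : ℝ) ≤ ⌈2 / (σ / 48)⌉₊ := Nat.cast_nonneg _
  -- With `τ = σ / 48`, `24 * τ = σ / 2` fits strictly inside both gaps; `J = ⌈2 / τ⌉` makes `p ^ 2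
  -- ≤ r ^ J`.
  refine ⟨σ / 48, σ / 48 / (20 * (⌈2 / (σ / 48)⌉₊ : ℝ) + 20), ⌈2 / (σ / 48)⌉₊, by positivity,
    by positivity, ?_, ?_, ?_, by linarith, by linarith⟩
  · rw [div_le_one (by positivity)]; linarith
  · have := Nat.le_ceil (2 / (σ / 48))
    rwa [div_le_iff₀' (by positivity)] at this
  · field_simp

/-- For large `P` the powers of `P` absorb the constants. -/
theorem exists_threshold {α τ γ c₁ c₂ M : ℝ} (hγ : 0 < γ) (hc₁ : 0 < c₁)
    (h₁ : 1 / 2 + 24 * τ < α) (h₂ : α + 8 * τ < 1) :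
    ∃ X : ℝ, 1 ≤ X ∧ ∀ P : ℝ, X ≤ P → 4 ≤ P ^ (γ / 2) ∧ M ≤ P ^ γ ∧
      P ^ (1 / 2 + 24 * τ) ≤ c₁ * P ^ α ∧ c₂ * P ^ (α + 8 * τ) ≤ P := by
  have e1 := (tendsto_rpow_atTop (half_pos hγ)).eventually_ge_atTop 4
  have e2 := (tendsto_rpow_atTop hγ).eventually_ge_atTop M
  have e3 := (tendsto_rpow_atTop (sub_pos.2 h₁)).eventually_ge_atTop (1 / c₁)
  have e4 := (tendsto_rpow_atTop (sub_pos.2 h₂)).eventually_ge_atTop c₂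
  obtain ⟨X, hX⟩ := eventually_atTop.1 (e1.and (e2.and (e3.and e4)))
  refine ⟨max X 1, le_max_right _ _, fun P hP => ?_⟩
  obtain ⟨h4, hM, h5, h6⟩ := hX P ((le_max_left _ _).trans hP)
  have hP0 : 0 < P := lt_of_lt_of_le one_pos ((le_max_right _ _).trans hP)
  refine ⟨h4, hM, ?_, ?_⟩
  · rw [Real.rpow_sub hP0, div_le_div_iff₀ hc₁ (by positivity)] at h5
    linarith
  · rw [Real.rpow_sub hP0, le_div_iff₀ (by positivity), Real.rpow_one] at h6
    exact h6

theorem card_fiber_le_maxFiber {p : ℕ} [Fact p.Prime] {G : Subgroup (ZMod p)ˣ} (φ : G → ZMod p)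
    (A : Finset G) (s : ZMod p) {_ : DecidablePred fun x : A => φ x = s} :
    (univ.filter fun x : A => φ x = s).card ≤ maxFiber φ := by
  have h1 : {x : G | φ x = s}.ncard ≤ maxFiber φ :=
    le_sup (f := fun t : ZMod p => {x : G | φ x = t}.ncard) (mem_univ s)
  refine le_trans ?_ h1
  rw [← card_map (Function.Embedding.subtype (· ∈ A)), ← Set.ncard_coe_finset]
  refine Set.ncard_le_ncard ?_ (Set.toFinite _)
  intro x hx
  simp only [coe_map, Set.mem_image, mem_coe, mem_filter, mem_univ, true_and] at hx
  obtain ⟨y, hy, rfl⟩ := hx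
  exact hy

end AffineWalk

theorem theorem2p6 (α : ℝ) (hα₁ : 1 / 2 < α) (hα₂ : α < 1) :
    ∃ Δ : ℝ, 0 < Δ ∧
      ∀ (c₁ c₂ : ℝ) (m M : ℕ), 0 < c₁ → 0 < c₂ →
        ∃ c : ℝ, 0 < c ∧
          ∀ (p : ℕ) [Fact p.Prime] (G : Subgroup (ZMod p)ˣ) (g h : G → (ZMod p)ˣ)
            (w : G → ZMod p) (A : Finset G),
            maxFiber (fun x => (g x : ZMod p)) ≤ m →
            maxFiber w ≤ M →
            c₁ * (p : ℝ) ^ α ≤ (A.card : ℝ) →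
            (A.card : ℝ) ≤ c₂ * (p : ℝ) ^ α →
            c * (A.card : ℝ) ^ (1 + Δ) ≤
              max ((Finset.image₂ (twoVar g h) A A).card : ℝ)
                ((Finset.image₂ (addShift w (twoVar g h)) A A).card : ℝ) := by
  obtain ⟨τ, γ, J, hτ, hγ, hγ1, hJ, hγJ, h₁, h₂⟩ := AffineWalk.exists_exponents α hα₁ hα₂
  -- The growth factor is `K = |A| ^ (γ / 2)`, and `4 ≤ p ^ (γ / 2)` for large `p` then gives `4 * K
  -- ≤ p ^ γ = Q`.
  refine ⟨γ / 2, by positivity, fun c₁ c₂ m M hc₁ hc₂ => ?_⟩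
  obtain ⟨X, hX1, hX⟩ := AffineWalk.exists_threshold (c₂ := c₂)
    (M := max (max (m : ℝ) M) 6) hγ hc₁ h₁ h₂
  have hX0 : 0 < X := by linarith
  -- The constant only serves `p < X`, where `|A| ^ (1 + γ / 2) ≤ X ^ 2` and the image is nonempty;
  -- for larger `p` it is enough that it is at most `1`.
  refine ⟨1 / X ^ 2, by positivity, fun p _ G g h w A hg hw hA₁ hA₂ => ?_⟩
  have hp : (0 : ℝ) < p := by exact_mod_cast (Fact.out : p.Prime).pos
  have hp1 : (1 : ℝ) ≤ p := by exact_mod_cast (Fact.out : p.Prime).one_le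
  have hApos : (0 : ℝ) < A.card := lt_of_lt_of_le (by positivity) hA₁
  have hA : A.Nonempty := Finset.card_pos.1 (by exact_mod_cast hApos)
  have hA1 : (1 : ℝ) ≤ A.card := by exact_mod_cast hA.card_pos
  set ψ : G → ZMod p := fun y => ((y : (ZMod p)ˣ) : ZMod p) with hψ
  have hψinj : Function.Injective ψ := Units.val_injective.comp Subtype.val_injective
  have hcard : (A.image ψ).card = A.card := Finset.card_image_of_injective A hψinj
  have hAp : (A.card : ℝ) ≤ p := by
    have := Finset.card_le_univ (A.image ψ)
    rw [hcard, ZMod.card] at this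
    exact_mod_cast this
  have hX2 : 1 / X ^ 2 ≤ 1 := by
    rw [div_le_one (by positivity)]; nlinarith
  rcases lt_or_ge (p : ℝ) X with hpX | hpX
  · have h1 : (A.card : ℝ) ^ (1 + γ / 2) ≤ X ^ 2 := by
      calc (A.card : ℝ) ^ (1 + γ / 2) ≤ (A.card : ℝ) ^ (2 : ℝ) :=
            Real.rpow_le_rpow_of_exponent_le hA1 (by linarith)
        _ = (A.card : ℝ) ^ 2 := by exact_mod_cast Real.rpow_natCast (A.card : ℝ) 2
        _ ≤ X ^ 2 := by gcongr; linarith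
    have h2 : (1 : ℝ) ≤ (Finset.image₂ (twoVar g h) A A).card := by
      exact_mod_cast (hA.image₂ hA).card_pos
    refine le_trans ?_ (h2.trans (le_max_left _ _))
    rw [one_div, inv_mul_le_iff₀ (by positivity)]
    linarith
  · obtain ⟨hP4, hPM, hP1, hP2⟩ := hX p hpX
    have hne : Nonempty A := hA.to_subtype
    have hQpow : ((p : ℝ) ^ γ) ^ (20 * J + 20) = (p : ℝ) ^ τ := by
      rw [← Real.rpow_natCast, ← Real.rpow_mul hp.le]
      congr 1
      push_cast
      exact hγJ
    have hrpow : ∀ k : ℕ, ((p : ℝ) ^ τ) ^ k = (p : ℝ) ^ (k * τ) := fun k => by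
      rw [← Real.rpow_natCast, ← Real.rpow_mul hp.le, mul_comm]
    have hmain := AffineWalk.max_lt_card_of_two_families (fun x : A => (g x : ZMod p))
      (fun x => (g x : ZMod p) * h x) (fun x => (g x).ne_zero) (fun x => w x) (A.image ψ)
      (Finset.image₂ (twoVar g h) A A) (Finset.image₂ (addShift w (twoVar g h)) A A)
      (hA.image ψ) ?_ ?_ ((A.card : ℝ) ^ (γ / 2)) m ((p : ℝ) ^ γ) ((p : ℝ) ^ τ) J ?_ ?_ ?_ ?_ ?_
      (Real.one_le_rpow hp1 hτ.le) ?_ hQpow.le ?_ ?_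
    · rw [hcard] at hmain
      refine le_trans ?_ hmain.le
      rw [add_comm, Real.rpow_add hApos, Real.rpow_one]
      exact mul_le_of_le_one_left (by positivity) hX2
    · intro x a ha
      obtain ⟨y, hy, rfl⟩ := Finset.mem_image.1 ha
      refine Finset.mem_image₂.2 ⟨x, x.2, y, hy, ?_⟩
      simp only [twoVar, hψ]
      ring
    · intro x a ha
      obtain ⟨y, hy, rfl⟩ := Finset.mem_image.1 ha
      refine Finset.mem_image₂.2 ⟨x, x.2, y, hy, ?_⟩
      simp only [addShift, twoVar, hψ]
      ring
    · intro s
      exact Nat.cast_le.2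
        ((AffineWalk.card_fiber_le_maxFiber (fun x => (g x : ZMod p)) A s).trans hg)
    · intro s
      refine le_trans ?_ (((le_max_right _ _).trans (le_max_left _ _)).trans hPM)
      exact Nat.cast_le.2 ((AffineWalk.card_fiber_le_maxFiber w A s).trans hw)
    · have h1 : (A.card : ℝ) ^ (γ / 2) ≤ (p : ℝ) ^ (γ / 2) := by gcongr
      calc 4 * (A.card : ℝ) ^ (γ / 2) ≤ (p : ℝ) ^ (γ / 2) * (p : ℝ) ^ (γ / 2) := by gcongr
        _ = (p : ℝ) ^ γ := by rw [← Real.rpow_add hp, add_halves]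
    · exact ((le_max_left _ _).trans (le_max_left _ _)).trans hPM
    · exact (le_max_right _ _).trans hPM
    · rw [ZMod.card, hrpow, ← Real.rpow_natCast]
      refine Real.rpow_le_rpow_of_exponent_le hp1 ?_
      push_cast
      linarith
    · rw [ZMod.card, hrpow, Real.sqrt_eq_rpow, ← Real.rpow_add hp, Fintype.card_coe]
      refine le_trans (le_of_eq ?_) (hP1.trans hA₁)
      congr 1
      push_cast
      ring
    · rw [hcard, ZMod.card, hrpow]
      calc (p : ℝ) ^ (((8 : ℕ) : ℝ) * τ) * A.card
          ≤ (p : ℝ) ^ (((8 : ℕ) : ℝ) * τ) * (c₂ * (p : ℝ) ^ α) := by gcongr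
        _ = c₂ * (p : ℝ) ^ (α + 8 * τ) := by
            rw [Real.rpow_add hp]
            push_cast
            ring
        _ ≤ p := hP2
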